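/- All Hilbert spaces are finite dimensional, nonzero and complex, with fixed orthonormal bases. $B_h(\mathcal H)$ is the real space of Hermitian operators, $\mathfrak S(\mathcal H)$ the set of density operators, $\|A\|_1=\mathrm{Tr}\,(A^*A)^{1/2}$. The Choi matrix of a linear map $\Phi:B(\mathcal H)\to B(\mathcal K)$ is $X_\Phi=(\Phi\otimes \mathrm{id}_{\mathcal H})(|\psi\rangle\langle\psi|)\in B(\mathcal K\otimes\mathcal H)$, $|\psi\rangle=\sum_i|i\rangle\otimes|i\rangle$; the map corresponding to $X$ is $\Phi_X(a)=\mathrm{Tr}_{\mathcal H}[(I\otimes a^{\mathsf T})X]$. For a sequence $\mathcal H_0,\mathcal H_1,\dots$ let $\mathcal C(\mathcal H_0,\mathcal H_1)$ be the set of Choi matrices of channels $B(\mathcal H_0)\to B(\mathcal H_1)$ and, for $n\ge 2$, let $\mathcal C(\mathcal H_0,\dots,\mathcal H_n)$ be the set of Choi matrices of completely positive maps $B(\mathcal H_{n-1}\otimes\dots\otimes\mathcal H_0)\to B(\mathcal H_n)$ that map $\mathcal C(\mathcal H_0,\dots,\mathcal H_{n-1})$ into $\mathfrak S(\mathcal H_n)$.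 (For $n=2N-1$ the elements of $\mathcal C(\mathcal H_0,\dots,\mathcal H_n)$ are called $N$-round strategies, or $N$-combs, and those of $\mathcal C(\mathcal H_0,\dots,\mathcal H_n,\mathbb C)$ are called $N$-round co-strategies.) For a set $B$ of positive operators on $\mathcal H$ and $X\in B_h(\mathcal H)$ put \[ \|X\|_B=\inf\{\lambda>0:\ X\in\lambda\mathcal O_B\},\qquad \mathcal O_B=\{x_1-x_2:\ x_1,x_2\ge 0,\ x_1+x_2\in B\}. \] **Theorem.** Let $n\ge 2$. On $B_h(\mathcal H_n\otimes\dots\otimes\mathcal H_0)$ both $\|\cdot\|_{\mathcal C(\mathcal H_0,\dots,\mathcal H_n)}$ and $\|\cdot\|_{\mathcal C(\mathcal H_0,\dots,\mathcal H_n,\mathbb C)}$ are norms. Let $X\in B_h(\mathcal H_n\otimes\dots\otimes \mathcal H_0)$ and let $\Phi: B(\mathcal H_{n-1}\otimes\dots\otimes \mathcal H_0)\to B(\mathcal H_n)$ be the corresponding map. Then \begin{align*} \|X\|_{\mathcal C(\mathcal H_0,\dots,\mathcal H_n)}&= \sup_{Y_1,Y_2\ge 0,\ Y_1+Y_2\in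 \mathcal C(\mathcal H_0,\dots,\mathcal H_n,\mathbb C)}\mathrm{Tr}\, X(Y_1-Y_2)\\ &= \sup_{Y\in \mathcal C(\mathcal H_0,\dots,\mathcal H_n,\mathbb C)} \|Y^{1/2}XY^{1/2}\|_1\\ &= \inf_{Y\in \mathcal C(\mathcal H_0,\dots,\mathcal H_n)}\inf\{\lambda>0:\ -\lambda Y\le X\le \lambda Y\}\\ &=\sup_{\dim(\mathcal L')<\infty}\ \sup_{Y\in \mathcal C(\mathcal H_0,\dots,\mathcal H_{n-2},\mathcal H_{n-1}\otimes \mathcal L')}\|(\Phi\otimes \mathrm{id}_{\mathcal L'})(Y)\|_1\\ &=\sup_{Y\in \mathcal C(\mathcal H_0,\dots,\mathcal H_{n-2},\mathcal H_{n-1}\otimes \mathcal L)}\|(\Phi\otimes \mathrm{id}_{\mathcal L})(Y)\|_1 \end{align*} for every $\mathcal L$ with $\dim(\mathcal L)=\dim(\mathcal H_{n-1}\otimes\dots\otimes\mathcal H_0)$ (an infimum over the empty set is $+\infty$, and in the last two lines $Y$ is read as an operator on $(\mathcal H_{n-1}\otimes\dots\otimes\mathcal H_0)\otimes\mathcal L$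 after reordering the tensor factors). Moreover, with respect to the pairing $(X,Z)\mapsto\mathrm{Tr}\,XZ$, the norm dual to $\|\cdot\|_{\mathcal C(\mathcal H_0,\dots,\mathcal H_n)}$ is \[ \|X\|^*_{\mathcal C(\mathcal H_0,\dots,\mathcal H_n)}=\|X\|_{I_{\mathcal H_n}\otimes \mathcal C(\mathcal H_0,\dots,\mathcal H_{n-1})}=\|X\|_{\mathcal C(\mathcal H_0,\dots,\mathcal H_n,\mathbb C)} =\sup_{S_0,S_1\ge0,\ S_0+S_1\in\mathcal C(\mathcal H_0,\dots,\mathcal H_n)}\mathrm{Tr}\,X(S_1-S_0). \] (For $n=2N-1$ the first two suprema are the formulas defining the strategy $N\diamond$-norm, and the last one is the formula for its dual norm.) -/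

import Mathlib

open scoped Matrix MatrixOrder ComplexOrder Kronecker

noncomputable section

namespace QSupermap

universe u v w

/-! Finite-dimensional Hilbert spaces with a fixed orthonormal basis are the spaces `ℂ^α`, `α` a
finite type; operators on them are matrices, and `ℂ^α ⊗ ℂ^β = ℂ^(α × β)`.
The partial order on matrices is `A ≤ B ↔ (B - A).PosSemidef`. -/

section Basic

variable {α : Type u} {κ : Type v}

/-- Density matrices: positive semidefinite matrices of trace one. -/
def states (κ : Type v) [Fintype κ] : Set (Matrix κ κ ℂ) :=
  {ρ | 0 ≤ ρ ∧ ρ.trace = 1}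

/-- `Φ ⊗ id_L`, acting on operators on `ℂ^α ⊗ ℂ^L`. -/
def tensorId (Φ : Matrix α α ℂ →ₗ[ℂ] Matrix κ κ ℂ) (L : Type w)
    (Z : Matrix (α × L) (α × L) ℂ) : Matrix (κ × L) (κ × L) ℂ :=
  Matrix.of fun p q => Φ (Matrix.of fun a b => Z (a, p.2) (b, q.2)) p.1 q.1

/-- Complete positivity: `Φ ⊗ id` is positive for every finite-dimensional ancilla. -/
def IsCP (Φ : Matrix α α ℂ →ₗ[ℂ] Matrix κ κ ℂ) : Prop :=
  ∀ (m : ℕ) (Z : Matrix (α × Fin m) (α × Fin m) ℂ), 0 ≤ Z → 0 ≤ tensorId Φ (Fin m) Z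

/-- The matrix `Ψ = |ψ⟩⟨ψ|` with `|ψ⟩ = ∑ i, |i⟩ ⊗ |i⟩`. -/
def maxEnt (α : Type u) [DecidableEq α] : Matrix (α × α) (α × α) ℂ :=
  Matrix.vecMulVec (fun p => if p.1 = p.2 then 1 else 0) (star fun p => if p.1 = p.2 then 1 else 0)

/-- The Choi matrix `(Φ ⊗ id)(Ψ)` of a linear map `Φ`. -/
def choi [DecidableEq α] (Φ : Matrix α α ℂ →ₗ[ℂ] Matrix κ κ ℂ) : Matrix (κ × α) (κ × α) ℂ :=
  tensorId Φ α (maxEnt α)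

/-- Partial trace over the second tensor factor. -/
def ptraceRight [Fintype α] (M : Matrix (κ × α) (κ × α) ℂ) : Matrix κ κ ℂ :=
  Matrix.of fun i j => ∑ s, M (i, s) (j, s)

/-- The linear map `Φ_X` with Choi matrix `X`: `Φ_X(a) = Tr₂ [(1 ⊗ aᵀ) X]`. -/
def mapOfChoi [Fintype α] [Fintype κ] [DecidableEq κ] (X : Matrix (κ × α) (κ × α) ℂ) :
    Matrix α α ℂ →ₗ[ℂ] Matrix κ κ ℂ where
  toFun a := ptraceRight (((1 : Matrix κ κ ℂ) ⊗ₖ aᵀ) * X)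
  map_add' a b := by
    ext i j
    simp [ptraceRight, Matrix.kronecker_add, Matrix.add_mul, Finset.sum_add_distrib]
  map_smul' c a := by
    ext i j
    simp [ptraceRight, Matrix.kronecker_smul, Finset.mul_sum]

theorem mapOfChoi_apply [Fintype α] [Fintype κ] [DecidableEq κ] (X : Matrix (κ × α) (κ × α) ℂ)
    (a : Matrix α α ℂ) (i j : κ) :
    mapOfChoi X a i j = ∑ s, ∑ t, a t s * X (i, t) (j, s) := by
  simp [mapOfChoi, ptraceRight, Matrix.mul_apply, Fintype.sum_prod_type, Matrix.one_apply]

/-- Mutual inverse, first half: `mapOfChoi X` has Choi matrix `X`. -/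
theorem choi_mapOfChoi [Fintype α] [DecidableEq α] [Fintype κ] [DecidableEq κ]
    (X : Matrix (κ × α) (κ × α) ℂ) : choi (mapOfChoi X) = X := by
  ext ⟨i, s⟩ ⟨j, t⟩
  simp [choi, tensorId, mapOfChoi_apply, maxEnt, Matrix.vecMulVec_apply]

/-- Mutual inverse, second half: `Φ` is recovered from its Choi matrix. -/
theorem mapOfChoi_choi [Fintype α] [DecidableEq α] [Fintype κ] [DecidableEq κ]
    (Φ : Matrix α α ℂ →ₗ[ℂ] Matrix κ κ ℂ) : mapOfChoi (choi Φ) = Φ := by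
  refine LinearMap.ext fun a => ?_
  ext i j
  have hE : ∀ s t : α, (Matrix.of fun a b => maxEnt α (a, s) (b, t)) = Matrix.single s t (1 : ℂ) := by
    intro s t
    ext a b
    by_cases h₁ : s = a <;> by_cases h₂ : t = b <;>
      simp [maxEnt, Matrix.vecMulVec_apply, eq_comm, h₁, h₂]
  conv_rhs => rw [Matrix.matrix_eq_sum_single a]
  simp only [mapOfChoi_apply, choi, tensorId, Matrix.of_apply, hE, map_sum, Matrix.sum_apply]
  rw [Finset.sum_comm]
  refine Finset.sum_congr rfl fun s _ => Finset.sum_congr rfl fun t _ => ?_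
  have : Matrix.single s t (a s t) = a s t • Matrix.single s t (1 : ℂ) := by simp
  rw [this, map_smul]
  simp

/-- Trace norm `‖A‖₁ = Tr |A|`, `|A| = (Aᴴ A)^(1/2)`. -/
def traceNorm [Fintype α] [DecidableEq α] (A : Matrix α α ℂ) : ℝ :=
  (CFC.sqrt (Aᴴ * A)).trace.re

/-- The Choi matrices of generalized channels with respect to `B`: completely positive maps that
send every element of `B` to a density matrix on `ℂ^κ`. -/
def genChannels [DecidableEq α] (B : Set (Matrix α α ℂ)) (κ : Type v) [Fintype κ] :
    Set (Matrix (κ × α) (κ × α) ℂ) :=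
  {X | ∃ Φ : Matrix α α ℂ →ₗ[ℂ] Matrix κ κ ℂ, IsCP Φ ∧ (∀ b ∈ B, Φ b ∈ states κ) ∧ X = choi Φ}

/-- The set `𝒪_B = {x₁ - x₂ : x₁, x₂ ≥ 0, x₁ + x₂ ∈ B}` of Hermitian matrices. -/
def unitSet (B : Set (Matrix α α ℂ)) : Set (Matrix α α ℂ) :=
  {x | ∃ x₁ x₂ : Matrix α α ℂ, 0 ≤ x₁ ∧ 0 ≤ x₂ ∧ x₁ + x₂ ∈ B ∧ x = x₁ - x₂}

/-- The norm `‖x‖_B = inf {λ > 0 : x ∈ λ 𝒪_B}` on Hermitian matrices, whose unit ball is `𝒪_B`. -/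
def baseNorm (B : Set (Matrix α α ℂ)) (x : Matrix α α ℂ) : ℝ :=
  gauge (unitSet B) x

/-- `f` restricts to a norm on the real vector space of Hermitian matrices. -/
def IsNormOnHermitian (f : Matrix α α ℂ → ℝ) : Prop :=
  (∀ x : Matrix α α ℂ, x.IsHermitian → 0 ≤ f x ∧ (f x = 0 → x = 0)) ∧
  (∀ (c : ℝ) (x : Matrix α α ℂ), x.IsHermitian → f (c • x) = |c| * f x) ∧
  (∀ x y : Matrix α α ℂ, x.IsHermitian → y.IsHermitian → f (x + y) ≤ f x + f y)

/-- The set `I ⊗ B = {1 ⊗ b : b ∈ B}`. -/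
def oneTensor (κ : Type v) [DecidableEq κ] (B : Set (Matrix α α ℂ)) :
    Set (Matrix (κ × α) (κ × α) ℂ) :=
  {y | ∃ b ∈ B, y = (1 : Matrix κ κ ℂ) ⊗ₖ b}

end Basic

section Sequence

variable (H : ℕ → Type u)

/-- Index set of `ℋ_n ⊗ ⋯ ⊗ ℋ_0`, where `ℋ_i = ℂ^(H i)`. -/
def Sys : ℕ → Type u
  | 0 => H 0
  | n + 1 => H (n + 1) × Sys n

instance Sys.instFintype [∀ i, Fintype (H i)] : ∀ n, Fintype (Sys H n)
  | 0 => inferInstanceAs (Fintype (H 0))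
  | n + 1 =>
    letI := Sys.instFintype n
    inferInstanceAs (Fintype (H (n + 1) × Sys H n))

instance Sys.instDecidableEq [∀ i, DecidableEq (H i)] : ∀ n, DecidableEq (Sys H n)
  | 0 => inferInstanceAs (DecidableEq (H 0))
  | n + 1 =>
    letI := Sys.instDecidableEq n
    inferInstanceAs (DecidableEq (H (n + 1) × Sys H n))

variable [∀ i, Fintype (H i)] [∀ i, DecidableEq (H i)]

/-- `𝒞(ℋ_0, …, ℋ_n)`. For `n ≥ 2` these are the Choi matrices of completely positive maps sending
`𝒞(ℋ_0, …, ℋ_{n-1})` into the density matrices on `ℋ_n`. The recursion starts with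
`𝒞(ℋ_0) = density matrices on ℋ_0`, so that `𝒞(ℋ_0, ℋ_1)` is the set of Choi matrices of completely
positive maps sending density matrices to density matrices, that is, of quantum channels. -/
def supermaps : (n : ℕ) → Set (Matrix (Sys H n) (Sys H n) ℂ)
  | 0 => states (H 0)
  | n + 1 => genChannels (supermaps n) (H (n + 1))

/-- `𝒞(ℋ_0, …, ℋ_n, ℂ^κ)`. -/
def supermapsTo (n : ℕ) (κ : Type v) [Fintype κ] :
    Set (Matrix (κ × Sys H n) (κ × Sys H n) ℂ) :=
  genChannels (supermaps H n) κ

/-- `𝒞(ℋ_0, …, ℋ_n, ℂ)`, as a set of operators on `ℂ ⊗ ℋ_n ⊗ ⋯ ⊗ ℋ_0 = ℋ_n ⊗ ⋯ ⊗ ℋ_0`. -/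
def costrategies (n : ℕ) : Set (Matrix (Sys H n) (Sys H n) ℂ) :=
  Matrix.reindex (Equiv.uniqueProd (Sys H n) Unit) (Equiv.uniqueProd (Sys H n) Unit) ''
    supermapsTo H n Unit

end Sequence

/-- Reordering `(ℋ ⊗ 𝓛) ⊗ 𝓢 = (ℋ ⊗ 𝓢) ⊗ 𝓛` of tensor factors, on operators. -/
def moveAncilla {η : Type u} {L : Type v} {σ : Type w}
    (Y : Matrix ((η × L) × σ) ((η × L) × σ) ℂ) : Matrix ((η × σ) × L) ((η × σ) × L) ℂ :=
  Matrix.of fun p q => Y ((p.1.1, p.2), p.1.2) ((q.1.1, q.2), q.1.2)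

/-- The values `‖(Φ ⊗ id_L)(Y)‖₁`, `Y ∈ 𝒞(ℋ_0, …, ℋ_{k-1}, ℋ_k ⊗ 𝓛)` with `k = j + 1 ≥ 1`, for a
linear map `Φ` from operators on `ℋ_k ⊗ ⋯ ⊗ ℋ_0` to operators on `ℂ^κ`. -/
def ancillaValues (H : ℕ → Type u) [∀ i, Fintype (H i)] [∀ i, DecidableEq (H i)]
    (j : ℕ) {κ : Type v} [Fintype κ] [DecidableEq κ]
    (Φ : Matrix (Sys H (j + 1)) (Sys H (j + 1)) ℂ →ₗ[ℂ] Matrix κ κ ℂ)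
    (L : Type w) [Fintype L] [DecidableEq L] : Set ℝ :=
  {r | ∃ Y ∈ supermapsTo H j (H (j + 1) × L), r = traceNorm (tensorId Φ L (moveAncilla Y))}

end QSupermap

end

open scoped Matrix MatrixOrder
open QSupermap

open scoped Matrix MatrixOrder ComplexOrder Kronecker

noncomputable section

namespace QSupermap

/-! ### The trace pairing on Hermitian matrices. -/

section TraceForm

variable {α : Type*} [Fintype α]

/-! Everything rests on one duality (`dualPair_supermaps`): `supermaps H n` and `costrategies H n`
are sections `K`, `L` of the positive cone, each consisting of all positive matrices that pair to
one with every element of the other, and each containing a positive multiple of the identity. By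
Choi's correspondence a map is completely positive iff its matrix is positive, and mapping `K` into
the states means that the partial trace of that matrix over the new output lies in `L`. The section
so defined has dual `I ⊗ K` (`DualPair.ptraceSection`), so the duality propagates by induction from
the pair (states, `{1}`).

All formulas without an ancilla hold for any dual pair. The base norm of `X` is the infimum of the
`r` with `-rY ≤ X ≤ rY` for some `Y ∈ K`. Pairing such bounds with `Y₁ - Y₂`, where `Y₁ + Y₂ ∈ L`,
gives weak duality; a Hahn-Banach supporting functional gives equality
(`DualPair.exists_mem_unitSet_trace_eq`). If `Y` is positive definite, its splittings into positive
parts are `√Y Qᵢ √Y` with `Q₁ + Q₂ = 1`, and optimizing over the `Qᵢ` turns the pairing into `‖√Y X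
√Y‖₁`; singular `Y` are reached by a limit.

For the ancilla formulas, `L` is `I ⊗ B` with `B` the set of multi-time inputs. Applying `Φ ⊗ id` to
a purification of `bᵀ` gives `√Y X √Y` with `Y = I ⊗ b`, up to relabelling (`exists_purification`),
so an ancilla as large as the input suffices. No ancilla gives more, because completely positive
maps preserve the order bounds on `X` (`DualPair.traceNorm_tensorId_le`). -/

theorem trace_mul_nonneg {A B : Matrix α α ℂ} (hA : 0 ≤ A) (hB : 0 ≤ B) :
    0 ≤ (A * B).trace := by
  classical
  obtain ⟨C, rfl⟩ := CStarAlgebra.nonneg_iff_eq_star_mul_self.mp hB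
  rw [← mul_assoc, Matrix.trace_mul_comm, ← mul_assoc]
  exact ((Matrix.nonneg_iff_posSemidef.mp hA).mul_mul_conjTranspose_same C).trace_nonneg

theorem trace_mul_re_mono {A B C : Matrix α α ℂ} (hC : 0 ≤ C) (h : A ≤ B) :
    (A * C).trace.re ≤ (B * C).trace.re := by
  have h1 := (Complex.le_def.mp (trace_mul_nonneg (sub_nonneg.mpr h) hC)).1
  rw [sub_mul, Matrix.trace_sub] at h1
  simpa using h1

theorem trace_mul_im_eq_zero {A B : Matrix α α ℂ} (hA : A.IsHermitian) (hB : B.IsHermitian) :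
    (A * B).trace.im = 0 := by
  have h : star (A * B).trace = (A * B).trace := by
    rw [← Matrix.trace_conjTranspose, Matrix.conjTranspose_mul, hA.eq, hB.eq,
      Matrix.trace_mul_comm]
  exact Complex.conj_eq_iff_im.mp h

omit [Fintype α] in
theorem isHermitian_real_smul {A : Matrix α α ℂ} (hA : A.IsHermitian) (c : ℝ) :
    (c • A).IsHermitian := by
  rw [Matrix.IsHermitian, Matrix.conjTranspose_smul, hA.eq, star_trivial]

theorem exists_le_smul_one [DecidableEq α] {A : Matrix α α ℂ} (hA : A.IsHermitian) :
    ∃ t : ℝ, 0 < t ∧ A ≤ t • (1 : Matrix α α ℂ) := by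
  obtain ⟨t, ht⟩ := (Set.finite_range hA.eigenvalues).bddAbove
  refine ⟨max t 1, by positivity, ?_⟩
  have h : A ≤ algebraMap ℝ (Matrix α α ℂ) (max t 1) := by
    refine le_algebraMap_of_spectrum_le (fun x hx => ?_) hA
    rw [hA.spectrum_real_eq_range_eigenvalues] at hx
    exact (ht hx).trans (le_max_left _ _)
  rwa [Algebra.algebraMap_eq_smul_one] at h

/-- Self-duality of the positive cone: rank-one `P = |x⟩⟨x|` turn the trace into the quadratic form
of `W`. -/
theorem nonneg_of_trace_mul_nonneg {W : Matrix α α ℂ} (hW : W.IsHermitian)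
    (h : ∀ P : Matrix α α ℂ, 0 ≤ P → 0 ≤ (W * P).trace.re) : 0 ≤ W := by
  refine (Matrix.PosSemidef.of_dotProduct_mulVec_nonneg hW fun x => ?_).nonneg
  have h1 : star x ⬝ᵥ W *ᵥ x = (W * Matrix.vecMulVec x (star x)).trace := by
    rw [Matrix.mul_vecMulVec, Matrix.trace_vecMulVec, dotProduct_comm]
  have hP := Matrix.posSemidef_vecMulVec_self_star x
  rw [h1, Complex.le_def]
  exact ⟨h _ hP.nonneg, (trace_mul_im_eq_zero hW hP.isHermitian).symm⟩

theorem eq_zero_of_trace_mul_self {W : Matrix α α ℂ} (hW : W.IsHermitian)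
    (h : (W * W).trace = 0) : W = 0 := by
  rw [← Matrix.trace_conjTranspose_mul_self_eq_zero_iff, hW.eq, h]

/-- The Hermitian part of a matrix. -/
def hermPart (A : Matrix α α ℂ) : Matrix α α ℂ := (1 / 2 : ℝ) • (A + Aᴴ)

omit [Fintype α] in
theorem isHermitian_hermPart (A : Matrix α α ℂ) : (hermPart A).IsHermitian :=
  isHermitian_real_smul (Matrix.isHermitian_add_transpose_self A) _

omit [Fintype α] in
theorem hermPart_of_isHermitian {A : Matrix α α ℂ} (hA : A.IsHermitian) : hermPart A = A := by
  rw [hermPart, hA.eq, ← two_smul ℝ A, smul_smul]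
  norm_num

omit [Fintype α] in
theorem hermPart_add (A B : Matrix α α ℂ) : hermPart (A + B) = hermPart A + hermPart B := by
  simp only [hermPart, Matrix.conjTranspose_add, ← smul_add]
  congr 1
  abel

omit [Fintype α] in
theorem hermPart_smul (c : ℝ) (A : Matrix α α ℂ) : hermPart (c • A) = c • hermPart A := by
  simp only [hermPart, Matrix.conjTranspose_smul, star_trivial, ← smul_add]
  rw [smul_comm]

/-- Real functionals on Hermitian matrices are represented by Hermitian matrices. -/
theorem exists_isHermitian_trace_mul_eq (f : Matrix α α ℂ →ₗ[ℝ] ℝ) :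
    ∃ W : Matrix α α ℂ, W.IsHermitian ∧
      ∀ A : Matrix α α ℂ, A.IsHermitian → f A = (W * A).trace.re := by
  classical
  -- `f` is only real-linear, so it is determined by its values on `E_ij` and `i·E_ij`; the minus
  -- sign is there because `Re (i·z) = -Im z`.
  let V : Matrix α α ℂ := Matrix.of fun j i =>
    ⟨f (Matrix.single i j 1), -f (Matrix.single i j Complex.I)⟩
  have hV : ∀ A, f A = (V * A).trace.re := by
    intro A
    have hA : A = ∑ i, ∑ j, ((A i j).re • Matrix.single i j (1 : ℂ) +
        (A i j).im • Matrix.single i j Complex.I) := by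
      conv_lhs => rw [Matrix.matrix_eq_sum_single A]
      refine Finset.sum_congr rfl fun i _ => Finset.sum_congr rfl fun j _ => ?_
      rw [Matrix.smul_single, Matrix.smul_single, ← Matrix.single_add]
      congr 1
      apply Complex.ext <;> simp
    conv_lhs => rw [hA]
    simp only [map_sum, map_add, map_smul, Matrix.trace, Matrix.diag_apply, Matrix.mul_apply,
      Complex.re_sum]
    rw [Finset.sum_comm]
    refine Finset.sum_congr rfl fun i _ => Finset.sum_congr rfl fun j _ => ?_
    simp [V, Complex.mul_re]
    ring
  refine ⟨hermPart V, isHermitian_hermPart V, fun A hA => ?_⟩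
  have h1 : (Vᴴ * A).trace.re = (V * A).trace.re := by
    have : (Vᴴ * A).trace = star (V * A).trace := by
      rw [← Matrix.trace_conjTranspose, Matrix.conjTranspose_mul, hA.eq, Matrix.trace_mul_comm]
    rw [this]
    simp
  rw [hV, hermPart, Matrix.smul_mul, Matrix.trace_smul, add_mul, Matrix.trace_add,
    Complex.smul_re, Complex.add_re, h1, smul_eq_mul]
  ring

end TraceForm

/-- Hahn-Banach: a sublinear function has a supporting functional at every point. -/
theorem exists_le_sublinear_eq_at {E : Type*} [AddCommGroup E] [Module ℝ E] (N : E → ℝ)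
    (N_hom : ∀ c : ℝ, 0 < c → ∀ x, N (c • x) = c * N x)
    (N_add : ∀ x y, N (x + y) ≤ N x + N y) (v : E) :
    ∃ g : E →ₗ[ℝ] ℝ, g v = N v ∧ ∀ x, g x ≤ N x := by
  have N_0 : N 0 = 0 := by
    have := N_hom 2 two_pos 0
    rw [smul_zero] at this
    linarith
  have H : ∀ c : ℝ, c • v = 0 → RingHom.id ℝ c • N v = 0 := fun c hc => by
    rcases smul_eq_zero.mp hc with rfl | rfl <;> simp [N_0]
  obtain ⟨g, hg1, hg⟩ := exists_extension_of_le_sublinear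
    (LinearPMap.mkSpanSingleton' v (N v) H) N N_hom N_add (by
      rintro ⟨x, hx⟩
      obtain ⟨c, rfl⟩ := Submodule.mem_span_singleton.mp hx
      rw [LinearPMap.mkSpanSingleton'_apply, smul_eq_mul, RingHom.id_apply]
      rcases lt_trichotomy c 0 with hc | rfl | hc
      -- For negative `c` subadditivity gives `0 = N 0 ≤ N (c • v) + N (-c • v)`.
      · have h1 := N_hom (-c) (by linarith) v
        have h2 := N_add (c • v) (-c • v)
        rw [neg_smul, add_neg_cancel, N_0, ← neg_smul, h1] at h2
        linarith
      · simp [N_0]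
      · rw [N_hom c hc])
  have hmem : v ∈ (LinearPMap.mkSpanSingleton' v (N v) H).domain :=
    Submodule.mem_span_singleton_self v
  refine ⟨g, ?_, hg⟩
  rw [hg1 ⟨v, hmem⟩]
  exact LinearPMap.mkSpanSingleton'_apply_self _ _ _ _

/-! ### Dual sections of the positive cone: base norms and strong duality. -/

section DualPair

variable {α : Type*} [Fintype α] [DecidableEq α]

/-- Mutually dual sections of the positive cone: each of `K`, `L` consists of all positive matrices
whose trace pairing with every element of the other is one, and each contains a positive multiple of
the identity. -/
structure DualPair (K L : Set (Matrix α α ℂ)) : Prop where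
  mem_left : ∀ X, X ∈ K ↔ 0 ≤ X ∧ ∀ Y ∈ L, (X * Y).trace = 1
  mem_right : ∀ Y, Y ∈ L ↔ 0 ≤ Y ∧ ∀ X ∈ K, (X * Y).trace = 1
  one_left : ∃ c : ℝ, 0 < c ∧ c • (1 : Matrix α α ℂ) ∈ K
  one_right : ∃ c : ℝ, 0 < c ∧ c • (1 : Matrix α α ℂ) ∈ L

/-- The numbers `r > 0` with `-(r • Y) ≤ Z ≤ r • Y` for some `Y ∈ K`. -/
def orderBounds (K : Set (Matrix α α ℂ)) (Z : Matrix α α ℂ) : Set ℝ :=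
  {r : ℝ | 0 < r ∧ ∃ Y ∈ K, -(r • Y) ≤ Z ∧ Z ≤ r • Y}

-- The substitution `Y = x₁ + x₂`, `Z = r(x₁ - x₂)` is inverted by `x₁ = (rY + Z)/2r`, `x₂ = (rY -
-- Z)/2r`, so a decomposition in `r 𝒪_K` is the same as a two-sided order bound.
omit [DecidableEq α] in
theorem baseNorm_eq_sInf_orderBounds (K : Set (Matrix α α ℂ)) (Z : Matrix α α ℂ) :
    baseNorm K Z = sInf (orderBounds K Z) := by
  rw [baseNorm, gauge_def]
  congr 1
  ext r
  refine and_congr_right fun hr => ?_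
  have hr : (0 : ℝ) < r := hr
  rw [Set.mem_smul_set]
  constructor
  · rintro ⟨x, ⟨x₁, x₂, h₁, h₂, hK, rfl⟩, rfl⟩
    refine ⟨_, hK, ?_, ?_⟩
    · rw [← sub_nonneg]
      have : r • (x₁ - x₂) - -(r • (x₁ + x₂)) = (2 * r) • x₁ := by module
      rw [this]
      exact smul_nonneg (by positivity) h₁
    · rw [← sub_nonneg]
      have : r • (x₁ + x₂) - r • (x₁ - x₂) = (2 * r) • x₂ := by module
      rw [this]
      exact smul_nonneg (by positivity) h₂
  · rintro ⟨Y, hY, h₁, h₂⟩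
    refine ⟨r⁻¹ • Z, ⟨(2 * r)⁻¹ • (Z - -(r • Y)), (2 * r)⁻¹ • (r • Y - Z),
      smul_nonneg (by positivity) (sub_nonneg.mpr h₁),
      smul_nonneg (by positivity) (sub_nonneg.mpr h₂), ?_, ?_⟩, ?_⟩
    · convert hY using 1
      match_scalars <;> field_simp <;> ring
    · match_scalars <;> field_simp <;> ring
    · rw [smul_smul, mul_inv_cancel₀ hr.ne', one_smul]

omit [Fintype α] [DecidableEq α] in
theorem bddBelow_orderBounds (K : Set (Matrix α α ℂ)) (Z : Matrix α α ℂ) :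
    BddBelow (orderBounds K Z) := ⟨0, fun _ hr => hr.1.le⟩

-- Weak duality. The scale `s` admits pairs whose sum is only proportional to an element of `L`, as
-- needed for definiteness and for the dual norm.
omit [DecidableEq α] in
theorem trace_mul_sub_le {K L : Set (Matrix α α ℂ)}
    (hL : ∀ Y ∈ L, 0 ≤ Y ∧ ∀ X ∈ K, (X * Y).trace = 1)
    {Z Y₁ Y₂ : Matrix α α ℂ} {r s : ℝ} (hr : r ∈ orderBounds K Z) (h₁ : 0 ≤ Y₁) (h₂ : 0 ≤ Y₂)
    {Y : Matrix α α ℂ} (hY : Y ∈ L) (hsum : Y₁ + Y₂ = s • Y) :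
    (Z * (Y₁ - Y₂)).trace.re ≤ r * s := by
  obtain ⟨hr, T, hT, hl, hu⟩ := hr
  have e1 := trace_mul_re_mono h₁ hu
  have e2 := trace_mul_re_mono h₂ hl
  have e3 : (T * (Y₁ + Y₂)).trace.re = s := by
    rw [hsum, Matrix.mul_smul, Matrix.trace_smul, (hL Y hY).2 T hT]
    simp
  simp only [mul_add, mul_sub, neg_mul, Matrix.smul_mul, Matrix.trace_add, Matrix.trace_sub,
    Matrix.trace_neg, Matrix.trace_smul, Complex.add_re, Complex.sub_re, Complex.neg_re,
    Complex.smul_re, smul_eq_mul] at *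
  rw [← e3]
  linarith

namespace DualPair

variable {K L : Set (Matrix α α ℂ)} (h : DualPair K L)

include h

theorem symm : DualPair L K where
  mem_left Y := by simpa only [Matrix.trace_mul_comm Y] using h.mem_right Y
  mem_right X := by
    rw [h.mem_left X]
    exact and_congr_right fun _ => forall₂_congr fun Y _ => by rw [Matrix.trace_mul_comm]
  one_left := h.one_right
  one_right := h.one_left

theorem nonneg {X : Matrix α α ℂ} (hX : X ∈ K) : 0 ≤ X := ((h.mem_left X).mp hX).1

theorem trace_eq {X Y : Matrix α α ℂ} (hX : X ∈ K) (hY : Y ∈ L) : (X * Y).trace = 1 :=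
  ((h.mem_left X).mp hX).2 Y hY

theorem convex : Convex ℝ K := by
  intro X hX Y hY a b ha hb hab
  rw [h.mem_left]
  refine ⟨add_nonneg (smul_nonneg ha (h.nonneg hX)) (smul_nonneg hb (h.nonneg hY)),
    fun T hT => ?_⟩
  rw [add_mul, Matrix.smul_mul, Matrix.smul_mul, Matrix.trace_add, Matrix.trace_smul,
    Matrix.trace_smul, h.trace_eq hX hT, h.trace_eq hY hT, ← add_smul, hab, one_smul]

theorem orderBounds_nonempty {Z : Matrix α α ℂ} (hZ : Z.IsHermitian) :
    (orderBounds K Z).Nonempty := by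
  obtain ⟨c, hc, hcK⟩ := h.one_left
  obtain ⟨t, ht, hZt⟩ := exists_le_smul_one hZ
  obtain ⟨s, hs, hZs⟩ := exists_le_smul_one hZ.neg
  have h1 : (0 : Matrix α α ℂ) ≤ 1 := Matrix.PosSemidef.one.nonneg
  have e : ((max t s) / c) • c • (1 : Matrix α α ℂ) = (max t s) • 1 := by
    rw [smul_smul, div_mul_cancel₀ _ hc.ne']
  refine ⟨max t s / c, by positivity, _, hcK, ?_, ?_⟩ <;> rw [e]
  · rw [neg_le]
    exact hZs.trans (smul_le_smul_of_nonneg_right (le_max_right _ _) h1)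
  · exact hZt.trans (smul_le_smul_of_nonneg_right (le_max_left _ _) h1)

/-- Nonemptiness of the set of bounds matters here: the real `sInf` of the empty set is `0`, not
`+∞`. -/
theorem isGLB_baseNorm {Z : Matrix α α ℂ} (hZ : Z.IsHermitian) :
    IsGLB (orderBounds K Z) (baseNorm K Z) := by
  rw [baseNorm_eq_sInf_orderBounds]
  exact isGLB_csInf (h.orderBounds_nonempty hZ) (bddBelow_orderBounds K Z)

theorem add_mem_orderBounds {Z W : Matrix α α ℂ} {r s : ℝ} (hr : r ∈ orderBounds K Z)
    (hs : s ∈ orderBounds K W) : r + s ∈ orderBounds K (Z + W) := by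
  obtain ⟨hr, Y, hY, h1, h2⟩ := hr
  obtain ⟨hs, T, hT, h3, h4⟩ := hs
  have e : (r + s) • ((r / (r + s)) • Y + (s / (r + s)) • T) = r • Y + s • T := by
    match_scalars <;> field_simp
  refine ⟨by positivity, _, h.convex hY hT (a := r / (r + s)) (b := s / (r + s))
    (by positivity) (by positivity) (by field_simp), ?_, ?_⟩ <;> rw [e]
  · rw [neg_add]
    exact add_le_add h1 h3
  · exact add_le_add h2 h4

theorem baseNorm_add_le {Z W : Matrix α α ℂ} (hZ : Z.IsHermitian) (hW : W.IsHermitian) :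
    baseNorm K (Z + W) ≤ baseNorm K Z + baseNorm K W := by
  have hg := (h.isGLB_baseNorm (hZ.add hW)).1
  have h1 : baseNorm K (Z + W) - baseNorm K W ≤ baseNorm K Z := by
    refine (h.isGLB_baseNorm hZ).2 fun r hr => ?_
    have h2 : baseNorm K (Z + W) - r ≤ baseNorm K W := by
      refine (h.isGLB_baseNorm hW).2 fun s hs => ?_
      linarith [hg (h.add_mem_orderBounds hr hs)]
    linarith
  linarith

theorem eq_zero_of_baseNorm_eq_zero {Z : Matrix α α ℂ} (hZ : Z.IsHermitian)
    (h0 : baseNorm K Z = 0) : Z = 0 := by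
  -- `Tr Z² = 0`, because pairings with `Z` are bounded by every order bound
  obtain ⟨c, hc, hcL⟩ := h.one_right
  obtain ⟨t, ht, hZt⟩ := exists_le_smul_one hZ
  obtain ⟨s, hs, hZs⟩ := exists_le_smul_one hZ.neg
  set m := max t s
  have hm : 0 < m := lt_max_of_lt_left ht
  have h1 : (0 : Matrix α α ℂ) ≤ 1 := Matrix.PosSemidef.one.nonneg
  have hZm : Z ≤ m • 1 := hZt.trans (smul_le_smul_of_nonneg_right (le_max_left _ _) h1)
  have hZm' : -Z ≤ m • 1 := hZs.trans (smul_le_smul_of_nonneg_right (le_max_right _ _) h1)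
  have hb : ∀ r ∈ orderBounds K Z, (Z * Z).trace.re * (c / m) ≤ r := by
    intro r hr
    -- The parts `(m ± Z)/2` are positive, differ by `Z`, and sum to `m • 1 = (m / c) • (c • 1)`.
    have := trace_mul_sub_le (fun Y hY => (h.mem_right Y).mp hY) hr
      (Y₁ := (1 / 2 : ℝ) • (m • 1 + Z)) (Y₂ := (1 / 2 : ℝ) • (m • 1 - Z)) (s := m / c)
      (smul_nonneg (by norm_num) (neg_le_iff_add_nonneg'.mp (neg_le.mp hZm')))
      (smul_nonneg (by norm_num) (sub_nonneg.mpr hZm)) hcL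
      (by match_scalars <;> field_simp <;> ring)
    have e : (1 / 2 : ℝ) • (m • 1 + Z) - (1 / 2 : ℝ) • (m • 1 - Z) = Z := by
      match_scalars <;> ring
    rw [e] at this
    calc _ ≤ r * (m / c) * (c / m) := by gcongr
      _ = r := by field_simp
  have h2 := (h.isGLB_baseNorm hZ).2 hb
  rw [h0] at h2
  have h3 : (Z * Z).trace.re ≤ 0 := by
    by_contra hcon
    push Not at hcon
    have : 0 < (Z * Z).trace.re * (c / m) := by positivity
    linarith
  have h4 : 0 ≤ (Z * Z).trace := by
    have := (Matrix.posSemidef_conjTranspose_mul_self Z).trace_nonneg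
    rwa [hZ.eq] at this
  refine eq_zero_of_trace_mul_self hZ (Complex.ext ?_ (trace_mul_im_eq_zero hZ hZ))
  exact le_antisymm h3 (Complex.le_def.mp h4).1

theorem isNormOnHermitian_baseNorm : IsNormOnHermitian (baseNorm K) := by
  refine ⟨fun x hx => ⟨gauge_nonneg x, h.eq_zero_of_baseNorm_eq_zero hx⟩, fun c x _ => ?_,
    fun x y hx hy => h.baseNorm_add_le hx hy⟩
  have hneg : ∀ y, baseNorm K (-y) = baseNorm K y := gauge_neg (by
    rintro x ⟨x₁, x₂, h₁, h₂, hK, rfl⟩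
    exact ⟨x₂, x₁, h₂, h₁, by rwa [add_comm], by abel⟩)
  have hpos : ∀ (a : ℝ), 0 ≤ a → baseNorm K (a • x) = a * baseNorm K x := fun a ha =>
    gauge_smul_of_nonneg ha x
  rcases le_total 0 c with hc | hc
  · rw [hpos c hc, abs_of_nonneg hc]
  · rw [← hneg, ← neg_smul, hpos _ (neg_nonneg.mpr hc), abs_of_nonpos hc]

theorem trace_mul_sub_le_baseNorm {Z Y₁ Y₂ : Matrix α α ℂ} (hZ : Z.IsHermitian) (h₁ : 0 ≤ Y₁)
    (h₂ : 0 ≤ Y₂) (hY : Y₁ + Y₂ ∈ L) : (Z * (Y₁ - Y₂)).trace.re ≤ baseNorm K Z :=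
  (h.isGLB_baseNorm hZ).2 fun r hr => by
    simpa using trace_mul_sub_le (fun Y hY => (h.mem_right Y).mp hY) hr h₁ h₂ hY
      (one_smul ℝ _).symm

/-- Strong duality: the base norm is attained as a pairing with an element of the unit ball of the
dual section. -/
theorem exists_mem_unitSet_trace_eq {Z : Matrix α α ℂ} (hZ : Z.IsHermitian) :
    ∃ Y₁ Y₂ : Matrix α α ℂ, 0 ≤ Y₁ ∧ 0 ≤ Y₂ ∧ Y₁ + Y₂ ∈ L ∧
      (Z * (Y₁ - Y₂)).trace.re = baseNorm K Z := by
  obtain ⟨c, hc, hcL⟩ := h.one_right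
  obtain ⟨d, hd, hdK⟩ := h.one_left
  -- `S (A, B)`: the `t` such that some Hermitian matrix dominates `A` and `B` and has constant
  -- pairing `t` with `L`
  let S : Matrix α α ℂ × Matrix α α ℂ → Set ℝ := fun u =>
    {t : ℝ | ∃ Y : Matrix α α ℂ, Y.IsHermitian ∧ (∀ T ∈ L, (Y * T).trace = (t : ℂ)) ∧
      hermPart u.1 ≤ Y ∧ hermPart u.2 ≤ Y}
  have S_add : ∀ u v s t, s ∈ S u → t ∈ S v → s + t ∈ S (u + v) := by
    rintro u v s t ⟨Y, hY, hYs, h1, h2⟩ ⟨T, hT, hTs, h3, h4⟩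
    refine ⟨Y + T, hY.add hT, fun V hV => ?_, ?_, ?_⟩
    · rw [add_mul, Matrix.trace_add, hYs V hV, hTs V hV, Complex.ofReal_add]
    · rw [Prod.fst_add, hermPart_add]; exact add_le_add h1 h3
    · rw [Prod.snd_add, hermPart_add]; exact add_le_add h2 h4
  have S_smul : ∀ u s (a : ℝ), 0 ≤ a → s ∈ S u → a * s ∈ S (a • u) := by
    rintro u s a ha ⟨Y, hY, hYs, h1, h2⟩
    refine ⟨a • Y, isHermitian_real_smul hY a, fun V hV => ?_, ?_, ?_⟩
    · rw [Matrix.smul_mul, Matrix.trace_smul, hYs V hV, Complex.real_smul, Complex.ofReal_mul]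
    · rw [Prod.smul_fst, hermPart_smul]; exact smul_le_smul_of_nonneg_left h1 ha
    · rw [Prod.smul_snd, hermPart_smul]; exact smul_le_smul_of_nonneg_left h2 ha
  have S_bdd : ∀ u, BddBelow (S u) := by
    refine fun u => ⟨(hermPart u.1 * c • 1).trace.re, ?_⟩
    rintro t ⟨Y, hY, hYs, h1, -⟩
    have := trace_mul_re_mono (h.symm.nonneg hcL) h1
    rwa [hYs _ hcL, Complex.ofReal_re] at this
  have d_trace : ∀ (t : ℝ), ∀ T ∈ L,
      ((t / d) • d • (1 : Matrix α α ℂ) * T).trace = ((t / d : ℝ) : ℂ) := by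
    intro t T hT
    rw [Matrix.smul_mul, Matrix.trace_smul, h.trace_eq hdK hT, Complex.real_smul, mul_one]
  have h1 : (0 : Matrix α α ℂ) ≤ 1 := Matrix.PosSemidef.one.nonneg
  have S_ne : ∀ u, (S u).Nonempty := by
    intro u
    obtain ⟨t, ht, hZt⟩ := exists_le_smul_one (isHermitian_hermPart u.1)
    obtain ⟨s, hs, hZs⟩ := exists_le_smul_one (isHermitian_hermPart u.2)
    refine ⟨max t s / d, (max t s / d) • d • 1, ?_, d_trace _, ?_, ?_⟩
    · exact isHermitian_real_smul (isHermitian_real_smul Matrix.isHermitian_one _) _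
    · rw [smul_smul, div_mul_cancel₀ _ hd.ne']
      exact hZt.trans (smul_le_smul_of_nonneg_right (le_max_left _ _) h1)
    · rw [smul_smul, div_mul_cancel₀ _ hd.ne']
      exact hZs.trans (smul_le_smul_of_nonneg_right (le_max_right _ _) h1)
  have S_glb : ∀ u, IsGLB (S u) (sInf (S u)) := fun u => isGLB_csInf (S_ne u) (S_bdd u)
  have N_add : ∀ u v, sInf (S (u + v)) ≤ sInf (S u) + sInf (S v) := by
    intro u v
    have h1 : sInf (S (u + v)) - sInf (S v) ≤ sInf (S u) := by
      refine (S_glb u).2 fun r hr => ?_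
      have h2 : sInf (S (u + v)) - r ≤ sInf (S v) := by
        refine (S_glb v).2 fun s hs => ?_
        linarith [(S_glb (u + v)).1 (S_add u v r s hr hs)]
      linarith
    linarith
  have N_le : ∀ a : ℝ, 0 < a → ∀ u, sInf (S (a • u)) ≤ a * sInf (S u) := by
    intro a ha u
    rw [← div_le_iff₀' ha]
    refine (S_glb u).2 fun r hr => ?_
    rw [div_le_iff₀' ha]
    exact (S_glb _).1 (S_smul u r a ha.le hr)
  have N_hom : ∀ a : ℝ, 0 < a → ∀ u, sInf (S (a • u)) = a * sInf (S u) := by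
    intro a ha u
    refine le_antisymm (N_le a ha u) ?_
    have := N_le a⁻¹ (inv_pos.mpr ha) (a • u)
    rwa [smul_smul, inv_mul_cancel₀ ha.ne', one_smul, ← div_eq_inv_mul, le_div_iff₀' ha] at this
  -- The value at `(Z, -Z)` is the norm of `Z`: dominating both components means `-Y ≤ Z ≤ Y`. The
  -- functional `g` splits into the two matrices sought.
  obtain ⟨g, hgv, hg⟩ := exists_le_sublinear_eq_at (fun u => sInf (S u)) N_hom N_add (Z, -Z)
  obtain ⟨W₁, hW₁, hg₁⟩ := exists_isHermitian_trace_mul_eq (g.comp (LinearMap.inl ℝ _ _))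
  obtain ⟨W₂, hW₂, hg₂⟩ := exists_isHermitian_trace_mul_eq (g.comp (LinearMap.inr ℝ _ _))
  have hgW : ∀ A B : Matrix α α ℂ, A.IsHermitian → B.IsHermitian →
      g (A, B) = (W₁ * A).trace.re + (W₂ * B).trace.re := by
    intro A B hA hB
    rw [← hg₁ A hA, ← hg₂ B hB, LinearMap.comp_apply, LinearMap.comp_apply, ← map_add]
    simp
  have g_le : ∀ (A B Y : Matrix α α ℂ) (t : ℝ), A.IsHermitian → B.IsHermitian → Y.IsHermitian →
      (∀ T ∈ L, (Y * T).trace = (t : ℂ)) → A ≤ Y → B ≤ Y →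
      (W₁ * A).trace.re + (W₂ * B).trace.re ≤ t := by
    intro A B Y t hA hB hY hYt h1 h2
    rw [← hgW A B hA hB]
    refine (hg _).trans ((S_glb _).1 ⟨Y, hY, hYt, ?_, ?_⟩)
    · rwa [hermPart_of_isHermitian hA]
    · rwa [hermPart_of_isHermitian hB]
  have z : (0 : Matrix α α ℂ).IsHermitian := Matrix.isHermitian_zero
  -- The pair `(-P, 0)` is dominated by `Y = 0` at level `0`, so the functional is nonpositive
  -- there.
  have hP₁ : 0 ≤ W₁ := nonneg_of_trace_mul_nonneg hW₁ fun P hP => by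
    have := g_le (-P) 0 0 0 (Matrix.nonneg_iff_posSemidef.mp hP).isHermitian.neg z z (by simp)
      (neg_nonpos.mpr hP) le_rfl
    simpa using this
  have hP₂ : 0 ≤ W₂ := nonneg_of_trace_mul_nonneg hW₂ fun P hP => by
    have := g_le 0 (-P) 0 0 z (Matrix.nonneg_iff_posSemidef.mp hP).isHermitian.neg z (by simp)
      le_rfl (neg_nonpos.mpr hP)
    simpa using this
  have hmem : W₁ + W₂ ∈ L := by
    rw [h.mem_right]
    refine ⟨add_nonneg hP₁ hP₂, fun X hX => ?_⟩
    have hXh := (Matrix.nonneg_iff_posSemidef.mp (h.nonneg hX)).isHermitian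
    -- Domination of `(X, X)` at level `1` and of `(-X, -X)` at level `-1` forces the pairing with
    -- `X` to be exactly one.
    have e1 := g_le X X X 1 hXh hXh hXh (fun T hT => by simpa using h.trace_eq hX hT) le_rfl le_rfl
    have e2 := g_le (-X) (-X) (-X) (-1) hXh.neg hXh.neg hXh.neg
      (fun T hT => by simpa using h.trace_eq hX hT) le_rfl le_rfl
    rw [Matrix.trace_mul_comm]
    refine Complex.ext ?_ (trace_mul_im_eq_zero (hW₁.add hW₂) hXh)
    simp only [mul_neg, Matrix.trace_neg, Complex.neg_re, add_mul, Matrix.trace_add,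
      Complex.add_re, Complex.one_re] at *
    linarith
  refine ⟨W₁, W₂, hP₁, hP₂, hmem, ?_⟩
  have e : (Z * (W₁ - W₂)).trace.re = sInf (S (Z, -Z)) := by
    rw [← hgv, hgW Z (-Z) hZ hZ.neg, Matrix.trace_mul_comm]
    rw [sub_mul, Matrix.trace_sub, Complex.sub_re, mul_neg, Matrix.trace_neg, Complex.neg_re,
      sub_eq_add_neg]
  refine le_antisymm (h.trace_mul_sub_le_baseNorm hZ hP₁ hP₂ hmem) ?_
  rw [e]
  refine (S_glb _).2 ?_
  rintro t ⟨Y, hY, hYt, h2, h3⟩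
  rw [hermPart_of_isHermitian hZ] at h2
  rw [hermPart_of_isHermitian hZ.neg] at h3
  -- Order bounds must be strictly positive, whereas `t` may vanish; adding `ε • d • 1` makes the
  -- level `t + ε` positive, so `Y` can be normalized into `K`.
  refine le_of_forall_pos_le_add fun ε hε => ?_
  have hY0 : 0 ≤ Y := by
    have h4 := add_nonneg (sub_nonneg.mpr h2) (sub_nonneg.mpr h3)
    have h5 := smul_nonneg (show (0 : ℝ) ≤ 1 / 2 by norm_num) h4
    convert h5 using 1
    match_scalars <;> norm_num
  have ht : 0 ≤ t := by
    have := (Complex.le_def.mp (trace_mul_nonneg hY0 (h.symm.nonneg hcL))).1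
    rwa [hYt _ hcL] at this
  have hd0 := smul_nonneg hε.le (h.nonneg hdK)
  have e1 : (t + ε) • (t + ε)⁻¹ • (Y + ε • d • (1 : Matrix α α ℂ)) = Y + ε • d • 1 := by
    rw [smul_smul, mul_inv_cancel₀ (by positivity), one_smul]
  refine (h.isGLB_baseNorm hZ).1 ⟨by positivity, (t + ε)⁻¹ • (Y + ε • d • 1), ?_, ?_, ?_⟩
  · rw [h.mem_left]
    refine ⟨smul_nonneg (by positivity) (add_nonneg hY0 hd0), fun T hT => ?_⟩
    rw [Matrix.smul_mul, Matrix.trace_smul, add_mul, Matrix.trace_add, hYt T hT,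
      Matrix.smul_mul ε, Matrix.trace_smul, h.trace_eq hdK hT, Complex.real_smul,
      Complex.real_smul, mul_one, ← Complex.ofReal_add, ← Complex.ofReal_mul,
      inv_mul_cancel₀ (by positivity), Complex.ofReal_one]
  · rw [e1, neg_le]
    exact h3.trans (le_add_of_nonneg_right hd0)
  · rw [e1]
    exact h2.trans (le_add_of_nonneg_right hd0)

end DualPair

end DualPair

/-! ### The trace norm and the variational formulas for base norms. -/

section TraceNorm

variable {α : Type*} [Fintype α] [DecidableEq α]

theorem le_abs_and_neg_abs_le {M : Matrix α α ℂ} (hM : M.IsHermitian) :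
    M ≤ CFC.abs M ∧ -CFC.abs M ≤ M := by
  constructor
  · rw [← sub_nonneg, CFC.abs_sub_self M hM]
    exact nsmul_nonneg (CFC.negPart_nonneg M) 2
  · rw [neg_le_iff_add_nonneg', CFC.abs_add_self M hM]
    exact nsmul_nonneg (CFC.posPart_nonneg M) 2

theorem trace_mul_sub_le_traceNorm {M Q₁ Q₂ : Matrix α α ℂ} (hM : M.IsHermitian) (h₁ : 0 ≤ Q₁)
    (h₂ : 0 ≤ Q₂) (h : Q₁ + Q₂ = 1) : (M * (Q₁ - Q₂)).trace.re ≤ traceNorm M := by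
  have e1 := trace_mul_re_mono h₁ (le_abs_and_neg_abs_le hM).1
  have e2 := trace_mul_re_mono h₂ (le_abs_and_neg_abs_le hM).2
  have e3 : traceNorm M = (CFC.abs M * (Q₁ + Q₂)).trace.re := by rw [h, mul_one]; rfl
  simp only [mul_add, mul_sub, neg_mul, Matrix.trace_add, Matrix.trace_sub,
    Matrix.trace_neg, Complex.add_re, Complex.sub_re, Complex.neg_re] at *
  linarith

/-- `Q₁` and `Q₂` are the spectral projections of `M` onto `[0, ∞)` and `(-∞, 0)`. -/
theorem exists_trace_mul_sub_eq_traceNorm {M : Matrix α α ℂ} (hM : M.IsHermitian) :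
    ∃ Q₁ Q₂ : Matrix α α ℂ, 0 ≤ Q₁ ∧ 0 ≤ Q₂ ∧ Q₁ + Q₂ = 1 ∧
      M * (Q₁ - Q₂) = CFC.abs M := by
  have hM' : IsSelfAdjoint M := hM
  -- Indicator functions are admissible in the functional calculus because the spectrum is finite.
  have hc : ∀ f : ℝ → ℝ, ContinuousOn f (spectrum ℝ M) := fun f =>
    (Matrix.finite_real_spectrum).continuousOn f
  refine ⟨cfc (fun x : ℝ => if 0 ≤ x then 1 else 0) M, cfc (fun x : ℝ => if 0 ≤ x then 0 else 1) M,
    cfc_nonneg fun x _ => ?_, cfc_nonneg fun x _ => ?_, ?_, ?_⟩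
  · split_ifs <;> norm_num
  · split_ifs <;> norm_num
  · rw [← cfc_add (hf := hc _) (hg := hc _), ← cfc_one ℝ M]
    refine cfc_congr fun x _ => ?_
    split_ifs <;> simp
  · rw [← cfc_sub (hf := hc _) (hg := hc _), CFC.abs_eq_cfc_norm M]
    nth_rewrite 1 [← cfc_id' ℝ M]
    rw [← cfc_mul (hf := hc _) (hg := hc _)]
    refine cfc_congr fun x _ => ?_
    split_ifs with hx
    · simp [abs_of_nonneg hx]
    · simp [abs_of_neg (not_le.mp hx)]

theorem traceNorm_le_of_neg_le_of_le {M R : Matrix α α ℂ} (hM : M.IsHermitian) (h₁ : -R ≤ M)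
    (h₂ : M ≤ R) : traceNorm M ≤ R.trace.re := by
  obtain ⟨Q₁, Q₂, hQ₁, hQ₂, hQ, h⟩ := exists_trace_mul_sub_eq_traceNorm hM
  have e1 := trace_mul_re_mono hQ₁ h₂
  have e2 := trace_mul_re_mono hQ₂ h₁
  have e3 : traceNorm M = (M * (Q₁ - Q₂)).trace.re := by rw [h]; rfl
  have e4 : R.trace.re = (R * (Q₁ + Q₂)).trace.re := by rw [hQ, mul_one]
  simp only [mul_add, mul_sub, neg_mul, Matrix.trace_add, Matrix.trace_sub,
    Matrix.trace_neg, Complex.add_re, Complex.sub_re, Complex.neg_re] at *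
  linarith

omit [DecidableEq α] in
theorem conjugate_mono {A B : Matrix α α ℂ} (C : Matrix α α ℂ) (hC : C.IsHermitian) (h : A ≤ B) :
    C * A * C ≤ C * B * C := by
  have := (Matrix.le_iff.mp h).mul_mul_conjTranspose_same C
  rw [hC.eq, mul_sub, sub_mul] at this
  exact this

/-- Refinements of a positive definite sum into two positive parts come from conjugation. -/
theorem trace_mul_sub_le_traceNorm_sqrt {X Y₁ Y₂ : Matrix α α ℂ} (hX : X.IsHermitian)
    (h₁ : 0 ≤ Y₁) (h₂ : 0 ≤ Y₂) (hY : (Y₁ + Y₂).PosDef) :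
    (X * (Y₁ - Y₂)).trace.re ≤
      traceNorm (CFC.sqrt (Y₁ + Y₂) * X * CFC.sqrt (Y₁ + Y₂)) := by
  set Y := Y₁ + Y₂
  set s := CFC.sqrt Y
  have hs : s.IsHermitian := (Matrix.nonneg_iff_posSemidef.mp (CFC.sqrt_nonneg Y)).isHermitian
  have hss : s * s = Y := CFC.sqrt_mul_sqrt_self Y hY.posSemidef.nonneg
  have hdet : IsUnit s.det := by
    have : IsUnit (s * s).det := by
      rw [hss]; exact (Matrix.isUnit_iff_isUnit_det _).mp hY.isUnit
    rw [Matrix.det_mul] at this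
    exact isUnit_of_mul_isUnit_left this
  have hi : s⁻¹.IsHermitian := hs.inv
  have hl : s⁻¹ * s = 1 := Matrix.nonsing_inv_mul s hdet
  have hr : s * s⁻¹ = 1 := Matrix.mul_nonsing_inv s hdet
  have hQ : ∀ Z : Matrix α α ℂ, s * (s⁻¹ * Z * s⁻¹) * s = Z := fun Z => by
    calc s * (s⁻¹ * Z * s⁻¹) * s = (s * s⁻¹) * Z * (s⁻¹ * s) := by simp only [mul_assoc]
      _ = Z := by rw [hl, hr, one_mul, mul_one]
  have hpos : ∀ Z : Matrix α α ℂ, 0 ≤ Z → 0 ≤ s⁻¹ * Z * s⁻¹ := fun Z hZ => by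
    simpa using conjugate_mono s⁻¹ hi hZ
  have hM : (s * X * s).IsHermitian := by
    have := Matrix.isHermitian_mul_mul_conjTranspose s hX
    rwa [hs.eq] at this
  -- The matrices `s⁻¹ Yᵢ s⁻¹` are positive and sum to `s⁻¹ s² s⁻¹ = 1`.
  have key := trace_mul_sub_le_traceNorm hM (hpos Y₁ h₁) (hpos Y₂ h₂) (by
    rw [← add_mul, ← mul_add]
    change s⁻¹ * Y * s⁻¹ = 1
    rw [← hss, ← mul_assoc, hl, one_mul, hr])
  convert key using 2
  rw [← sub_mul, ← mul_sub]
  calc (X * (Y₁ - Y₂)).trace = (X * (s * (s⁻¹ * (Y₁ - Y₂) * s⁻¹) * s)).trace := by rw [hQ]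
    _ = ((X * s * (s⁻¹ * (Y₁ - Y₂) * s⁻¹)) * s).trace := by simp only [mul_assoc]
    _ = (s * (X * s * (s⁻¹ * (Y₁ - Y₂) * s⁻¹))).trace := Matrix.trace_mul_comm _ _
    _ = _ := by simp only [mul_assoc]

namespace DualPair

variable {K L : Set (Matrix α α ℂ)} (h : DualPair K L)

include h

theorem isLUB_trace_mul_sub {X : Matrix α α ℂ} (hX : X.IsHermitian) :
    IsLUB {r : ℝ | ∃ Y₁ Y₂ : Matrix α α ℂ, 0 ≤ Y₁ ∧ 0 ≤ Y₂ ∧ Y₁ + Y₂ ∈ L ∧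
      r = (X * (Y₁ - Y₂)).trace.re} (baseNorm K X) := by
  constructor
  · rintro r ⟨Y₁, Y₂, h₁, h₂, hY, rfl⟩
    exact h.trace_mul_sub_le_baseNorm hX h₁ h₂ hY
  · intro u hu
    obtain ⟨Y₁, Y₂, h₁, h₂, hY, e⟩ := h.exists_mem_unitSet_trace_eq hX
    exact hu ⟨Y₁, Y₂, h₁, h₂, hY, e.symm⟩

/-- Conjugating `-rT ≤ X ≤ rT` by `√Y` bounds the trace norm by `r Tr (T Y) = r`. Conversely, an
optimal pair for strong duality is used, after its possibly singular sum is made positive definite.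
-/
theorem isLUB_traceNorm_sqrt {X : Matrix α α ℂ} (hX : X.IsHermitian) :
    IsLUB {r : ℝ | ∃ Y ∈ L, r = traceNorm (CFC.sqrt Y * X * CFC.sqrt Y)} (baseNorm K X) := by
  constructor
  · rintro r ⟨Y, hY, rfl⟩
    refine (h.isGLB_baseNorm hX).2 ?_
    rintro r ⟨hr, T, hT, hl, hu⟩
    set s := CFC.sqrt Y
    have hs : s.IsHermitian := (Matrix.nonneg_iff_posSemidef.mp (CFC.sqrt_nonneg Y)).isHermitian
    have hM : (s * X * s).IsHermitian := by
      have := Matrix.isHermitian_mul_mul_conjTranspose s hX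
      rwa [hs.eq] at this
    have e := traceNorm_le_of_neg_le_of_le (R := s * (r • T) * s) hM
      (by have := conjugate_mono s hs hl; rwa [mul_neg, neg_mul] at this)
      (conjugate_mono s hs hu)
    have e2 : (s * (r • T) * s).trace = r := by
      rw [Matrix.trace_mul_comm, ← mul_assoc, CFC.sqrt_mul_sqrt_self Y (h.symm.nonneg hY),
        Matrix.mul_smul, Matrix.trace_smul, Matrix.trace_mul_comm, h.trace_eq hT hY]
      simp
    rwa [e2, Complex.ofReal_re] at e
  · intro u hu
    obtain ⟨Y₁, Y₂, h₁, h₂, hY, e⟩ := h.exists_mem_unitSet_trace_eq hX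
    obtain ⟨c, hc, hcL⟩ := h.one_right
    -- Mixing in `c • 1` with weight `1 - t`, half to each part, leaves `Y₁ - Y₂` unchanged up to
    -- the factor `t`; then `t` tends to `1`.
    have hu' : ∀ t ∈ Set.Ioo (0 : ℝ) 1, t * baseNorm K X ≤ u := by
      rintro t ⟨ht0, ht1⟩
      have ht : 0 < 1 - t := by linarith
      have hp1 : (0 : Matrix α α ℂ) ≤ ((1 - t) * c / 2) • 1 :=
        smul_nonneg (by positivity) Matrix.PosSemidef.one.nonneg
      have esum : (t • Y₁ + ((1 - t) * c / 2) • (1 : Matrix α α ℂ)) +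
          (t • Y₂ + ((1 - t) * c / 2) • 1) = t • (Y₁ + Y₂) + (1 - t) • c • 1 := by
        match_scalars <;> ring
      have hpd : ((1 - t) • c • (1 : Matrix α α ℂ)).PosDef :=
        (Matrix.PosDef.one.smul hc).smul ht
      have key := trace_mul_sub_le_traceNorm_sqrt hX
        (add_nonneg (smul_nonneg ht0.le h₁) hp1) (add_nonneg (smul_nonneg ht0.le h₂) hp1) (by
          rw [esum]
          exact Matrix.PosDef.posSemidef_add
            (Matrix.nonneg_iff_posSemidef.mp (smul_nonneg ht0.le (h.symm.nonneg hY))) hpd)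
      refine le_trans ?_ (key.trans (hu ⟨_, ?_, rfl⟩))
      · rw [add_sub_add_right_eq_sub, ← smul_sub, Matrix.mul_smul, Matrix.trace_smul,
          Complex.smul_re, e, smul_eq_mul]
      · rw [esum]
        exact h.symm.convex hY hcL ht0.le ht.le (by ring)
    refine le_of_forall_pos_le_add fun ε hε => ?_
    have hb : 0 ≤ baseNorm K X := gauge_nonneg X
    have := hu' (1 - ε / (baseNorm K X + ε + 1)) ⟨by
      rw [sub_pos, div_lt_one (by positivity)]; linarith, by
      have : 0 < ε / (baseNorm K X + ε + 1) := by positivity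
      linarith⟩
    have h3 : ε / (baseNorm K X + ε + 1) * baseNorm K X ≤ ε := by
      rw [div_mul_eq_mul_div, div_le_iff₀ (by positivity)]
      nlinarith
    linarith

/-- The norm dual to `‖·‖_K` with respect to the trace pairing is `‖·‖_L`. -/
theorem isLUB_dual {X : Matrix α α ℂ} (hX : X.IsHermitian) :
    IsLUB {r : ℝ | ∃ Z : Matrix α α ℂ, Z.IsHermitian ∧ baseNorm K Z ≤ 1 ∧
      r = (X * Z).trace.re} (baseNorm L X) := by
  constructor
  · rintro _ ⟨Z, hZ, hZ1, rfl⟩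
    -- Weak duality with the roles of `K` and `L` exchanged, for the parts `(sY ± Z)/2` of `s • Y`.
    have hle : ∀ s ∈ orderBounds K Z, ∀ r ∈ orderBounds L X, (X * Z).trace.re ≤ r * s := by
      rintro s ⟨hs, Y, hY, h1, h2⟩ r hr
      have e : (1 / 2 : ℝ) • (s • Y + Z) - (1 / 2 : ℝ) • (s • Y - Z) = Z := by
        match_scalars <;> ring
      rw [← e]
      refine trace_mul_sub_le (fun Y hY => (h.symm.mem_right Y).mp hY) hr
        (smul_nonneg (by norm_num) (neg_le_iff_add_nonneg'.mp h1))
        (smul_nonneg (by norm_num) (sub_nonneg.mpr h2)) hY ?_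
      match_scalars <;> ring
    have hle1 : ∀ r ∈ orderBounds L X, (X * Z).trace.re ≤ r := by
      intro r hr
      have h2 : (X * Z).trace.re / r ≤ baseNorm K Z :=
        (h.isGLB_baseNorm hZ).2 fun s hs => by
          rw [div_le_iff₀' hr.1]
          exact hle s hs r hr
      have := h2.trans hZ1
      rwa [div_le_one hr.1] at this
    exact (h.symm.isGLB_baseNorm hX).2 hle1
  · intro u hu
    obtain ⟨Y₁, Y₂, h₁, h₂, hY, e⟩ := h.symm.exists_mem_unitSet_trace_eq hX
    rw [← e]
    refine hu ⟨Y₁ - Y₂, ?_, gauge_le_one_of_mem ⟨Y₁, Y₂, h₁, h₂, hY, rfl⟩, rfl⟩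
    exact (Matrix.nonneg_iff_posSemidef.mp h₁).isHermitian.sub
      (Matrix.nonneg_iff_posSemidef.mp h₂).isHermitian

end DualPair

end TraceNorm

/-! ### Partial traces, Choi matrices and complete positivity. -/

section PartialTrace

variable {α : Type*} {κ : Type*}

/-- Partial trace over the first tensor factor. -/
def ptraceLeft [Fintype κ] (M : Matrix (κ × α) (κ × α) ℂ) : Matrix α α ℂ :=
  Matrix.of fun s t => ∑ i, M (i, s) (i, t)

theorem trace_mul_one_kronecker [Fintype α] [Fintype κ] [DecidableEq κ]
    (X : Matrix (κ × α) (κ × α) ℂ) (b : Matrix α α ℂ) :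
    (X * ((1 : Matrix κ κ ℂ) ⊗ₖ b)).trace = (ptraceLeft X * b).trace := by
  simp only [Matrix.trace, Matrix.diag_apply, Matrix.mul_apply, Fintype.sum_prod_type, ptraceLeft,
    Matrix.of_apply, Matrix.kroneckerMap_apply, Matrix.one_apply, Finset.sum_mul]
  simp only [ite_mul, one_mul, zero_mul, mul_ite, mul_zero]
  rw [Finset.sum_comm]
  refine Finset.sum_congr rfl fun s _ => ?_
  rw [Finset.sum_comm]
  simp only [Finset.sum_comm (γ := α)]
  simp

/-- The transpose coming from the Choi convention is the reason why closure under transposition has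
to be carried through the recursion. -/
theorem trace_mapOfChoi [Fintype α] [Fintype κ] [DecidableEq κ]
    (X : Matrix (κ × α) (κ × α) ℂ) (b : Matrix α α ℂ) :
    (mapOfChoi X b).trace = (ptraceLeft X * bᵀ).trace := by
  simp only [Matrix.trace, Matrix.diag_apply, Matrix.mul_apply, ptraceLeft, Matrix.of_apply,
    mapOfChoi_apply, Matrix.transpose_apply, Finset.sum_mul]
  rw [Finset.sum_comm]
  simp only [Finset.sum_comm (γ := κ)]
  rw [Finset.sum_comm]
  simp only [mul_comm]

theorem ptraceLeft_nonneg [Fintype α] [Fintype κ] {X : Matrix (κ × α) (κ × α) ℂ} (hX : 0 ≤ X) :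
    0 ≤ ptraceLeft X := by
  have : ptraceLeft X = ∑ i, X.submatrix (fun s => (i, s)) (fun s => (i, s)) := by
    ext s t
    simp [ptraceLeft, Matrix.sum_apply]
  rw [this]
  exact Finset.sum_nonneg fun i _ =>
    ((Matrix.nonneg_iff_posSemidef.mp hX).submatrix _).nonneg

/-- Summing the blocks of a positive matrix gives a positive matrix. -/
theorem sum_blocks_nonneg {γ : Type*} [Fintype α] [Fintype γ] {M : Matrix (γ × α) (γ × α) ℂ}
    (hM : 0 ≤ M) : 0 ≤ Matrix.of fun p q => ∑ s, ∑ t, M (p, t) (q, s) := by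
  classical
  -- The block sum is `A M Aᴴ` for `A = 1 ⊗ (1, …, 1)`.
  have := (Matrix.nonneg_iff_posSemidef.mp hM).mul_mul_conjTranspose_same
    (Matrix.of fun (p : γ) (q : γ × α) => if p = q.1 then (1 : ℂ) else 0)
  convert this.nonneg using 1
  ext p q
  symm
  simp only [Matrix.mul_apply, Matrix.of_apply, Matrix.conjTranspose_apply, Fintype.sum_prod_type,
    apply_ite star, star_one, star_zero, mul_ite, mul_one, mul_zero, ite_mul, one_mul, zero_mul]
  rw [Finset.sum_comm]
  refine Finset.sum_congr rfl fun s _ => ?_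
  rw [Finset.sum_ite_eq, if_pos (Finset.mem_univ q), Finset.sum_comm]
  simp

/-- Maps with positive Choi matrix are completely positive. -/
theorem tensorId_mapOfChoi_nonneg [Fintype α] [Fintype κ] [DecidableEq κ] {Λ : Type*} [Fintype Λ]
    {X : Matrix (κ × α) (κ × α) ℂ} (hX : 0 ≤ X) {Z : Matrix (α × Λ) (α × Λ) ℂ} (hZ : 0 ≤ Z) :
    0 ≤ tensorId (mapOfChoi X) Λ Z := by
  have h1 := (Matrix.nonneg_iff_posSemidef.mp hX).kronecker (Matrix.nonneg_iff_posSemidef.mp hZ)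
  -- This submatrix of `X ⊗ Z` equates the two `α` indices, so that summing its blocks contracts
  -- them.
  have h2 := h1.submatrix (fun u : (κ × Λ) × α => ((u.1.1, u.2), (u.2, u.1.2)))
  convert sum_blocks_nonneg h2.nonneg using 1
  ext p q
  simp [tensorId, mapOfChoi_apply, mul_comm]

theorem mapOfChoi_nonneg [Fintype α] [Fintype κ] [DecidableEq κ]
    {X : Matrix (κ × α) (κ × α) ℂ} (hX : 0 ≤ X) {b : Matrix α α ℂ} (hb : 0 ≤ b) :
    0 ≤ mapOfChoi X b := by
  have h1 := tensorId_mapOfChoi_nonneg (Λ := Unit) hX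
    ((Matrix.nonneg_iff_posSemidef.mp hb).submatrix (Prod.fst : α × Unit → α)).nonneg
  exact ((Matrix.nonneg_iff_posSemidef.mp h1).submatrix (fun i : κ => (i, ()))).nonneg

theorem isCP_mapOfChoi [Fintype α] [Fintype κ] [DecidableEq κ] {X : Matrix (κ × α) (κ × α) ℂ}
    (hX : 0 ≤ X) : IsCP (mapOfChoi X) := fun _ _ hZ => tensorId_mapOfChoi_nonneg hX hZ

/-- The Choi matrix is the image of a positive matrix with ancilla `α`; a relabelling is needed
since `IsCP` quantifies over ancillas `Fin m`. -/
theorem IsCP.choi_nonneg [Fintype α] [DecidableEq α] {Φ : Matrix α α ℂ →ₗ[ℂ] Matrix κ κ ℂ}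
    (h : IsCP Φ) : 0 ≤ choi Φ := by
  let e := Fintype.equivFin α
  have h1 : (maxEnt α).PosSemidef := Matrix.posSemidef_vecMulVec_self_star _
  have h2 := h _ _ (h1.submatrix (Prod.map id e.symm)).nonneg
  have h3 := (Matrix.nonneg_iff_posSemidef.mp h2).submatrix (Prod.map (id : κ → κ) e)
  convert h3.nonneg using 1
  ext p q
  simp [choi, tensorId]

theorem nonneg_transpose {A : Matrix α α ℂ} (hA : 0 ≤ A) : 0 ≤ Aᵀ :=
  (Matrix.nonneg_iff_posSemidef.mp hA).transpose.nonneg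

theorem trace_mul_transpose [Fintype α] (A B : Matrix α α ℂ) :
    (A * Bᵀ).trace = (Aᵀ * B).trace := by
  rw [← Matrix.trace_transpose, Matrix.transpose_mul, Matrix.transpose_transpose,
    Matrix.trace_mul_comm]

end PartialTrace

/-! ### Dual pairs from states and from generalized channels. -/

section DualPair

variable {α : Type*} [Fintype α] [DecidableEq α] {κ : Type*} [Fintype κ] [DecidableEq κ]
  {K L : Set (Matrix α α ℂ)}

/-- If `Y` pairs to one with every state, rescaling makes `Y - 1` orthogonal to every positive
matrix, so both it and its negative are positive. -/
theorem dualPair_states [Nonempty α] : DualPair (states α) {1} where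
  mem_left X := by simp [states]
  mem_right Y := by
    constructor
    · rintro rfl
      exact ⟨Matrix.PosSemidef.one.nonneg, fun X hX => by rw [mul_one]; exact hX.2⟩
    · rintro ⟨hY, h⟩
      have hYh := (Matrix.nonneg_iff_posSemidef.mp hY).isHermitian
      have key : ∀ P : Matrix α α ℂ, 0 ≤ P → (Y * P).trace = P.trace := by
        intro P hP
        have hPp := Matrix.nonneg_iff_posSemidef.mp hP
        have htr : 0 ≤ P.trace := hPp.trace_nonneg
        have hre : P.trace = (P.trace.re : ℂ) := Complex.ext rfl (Complex.le_def.mp htr).2.symm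
        rcases eq_or_lt_of_le (Complex.le_def.mp htr).1 with h0 | h0
        · have h1 : P.trace = 0 := by rw [hre, ← h0]; rfl
          rw [hPp.trace_eq_zero_iff.mp h1]
          simp
        · have h0 : 0 < P.trace.re := h0
          have := h (P.trace.re⁻¹ • P) ⟨smul_nonneg (by positivity) hP, by
            rw [Matrix.trace_smul, hre, Complex.real_smul, Complex.ofReal_re, ← Complex.ofReal_mul,
              inv_mul_cancel₀ h0.ne', Complex.ofReal_one]⟩
          rw [Matrix.smul_mul, Matrix.trace_smul, Matrix.trace_mul_comm, Complex.real_smul,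
            Complex.ofReal_inv, ← hre, inv_mul_eq_one₀ (by rw [hre]; exact_mod_cast h0.ne')] at this
          exact this.symm
      have h1 : ∀ P : Matrix α α ℂ, 0 ≤ P → ((Y - 1) * P).trace = 0 := fun P hP => by
        rw [sub_mul, Matrix.trace_sub, key P hP, one_mul, sub_self]
      have hH : (Y - 1).IsHermitian := hYh.sub Matrix.isHermitian_one
      refine le_antisymm ?_ ?_
      · rw [← sub_nonneg, ← neg_sub]
        refine nonneg_of_trace_mul_nonneg hH.neg fun P hP => ?_
        rw [neg_mul, Matrix.trace_neg, h1 P hP]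
        simp
      · rw [← sub_nonneg]
        refine nonneg_of_trace_mul_nonneg hH fun P hP => ?_
        rw [h1 P hP]
        simp
  one_left := by
    have h0 : (0 : ℝ) < Fintype.card α := by exact_mod_cast Fintype.card_pos
    refine ⟨(Fintype.card α : ℝ)⁻¹, by positivity,
      smul_nonneg (by positivity) Matrix.PosSemidef.one.nonneg, ?_⟩
    rw [Matrix.trace_smul, Matrix.trace_one, Complex.real_smul, ← Complex.ofReal_natCast,
      ← Complex.ofReal_mul, inv_mul_cancel₀ h0.ne', Complex.ofReal_one]
  one_right := ⟨1, one_pos, by simp⟩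

/-- The matrices `X ≥ 0` on `ℂ^κ ⊗ ℂ^α` whose partial trace lies in `L`. -/
def ptraceSection (κ : Type*) [Fintype κ] (L : Set (Matrix α α ℂ)) :
    Set (Matrix (κ × α) (κ × α) ℂ) :=
  {X | 0 ≤ X ∧ ptraceLeft X ∈ L}

namespace DualPair

theorem transpose_mem_right (h : DualPair K L) (hT : ∀ b ∈ K, bᵀ ∈ K) : ∀ b ∈ L, bᵀ ∈ L := by
  intro b hb
  rw [h.mem_right]
  refine ⟨nonneg_transpose (h.symm.nonneg hb), fun X hX => ?_⟩
  rw [trace_mul_transpose]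
  exact h.trace_eq (hT X hX) hb

/-- Positivity of the Choi matrix encodes complete positivity. The condition `Tr Φ(b) = 1` on `K`
reads `Tr ((Tr_κ X) bᵀ) = 1`, which by closure of `K` under transposition says that the partial
trace lies in `L`. -/
theorem genChannels_eq (h : DualPair K L) (hT : ∀ b ∈ K, bᵀ ∈ K) :
    genChannels K κ = ptraceSection κ L := by
  ext X
  constructor
  · rintro ⟨Φ, hΦ, hB, rfl⟩
    refine ⟨hΦ.choi_nonneg, (h.mem_right _).mpr
      ⟨ptraceLeft_nonneg hΦ.choi_nonneg, fun b hb => ?_⟩⟩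
    have := trace_mapOfChoi (choi Φ) bᵀ
    rw [mapOfChoi_choi, (hB _ (hT b hb)).2, Matrix.transpose_transpose,
      Matrix.trace_mul_comm] at this
    exact this.symm
  · rintro ⟨hX, hL⟩
    refine ⟨mapOfChoi X, isCP_mapOfChoi hX, fun b hb => ⟨mapOfChoi_nonneg hX (h.nonneg hb), ?_⟩,
      (choi_mapOfChoi X).symm⟩
    rw [trace_mapOfChoi, Matrix.trace_mul_comm]
    exact h.trace_eq (hT b hb) hL

theorem reindex_genChannels_unit (h : DualPair K L) (hT : ∀ b ∈ K, bᵀ ∈ K) :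
    Matrix.reindex (Equiv.uniqueProd α Unit) (Equiv.uniqueProd α Unit) '' genChannels K Unit =
      L := by
  rw [h.genChannels_eq hT]
  ext Y
  constructor
  · rintro ⟨X, ⟨-, hX⟩, rfl⟩
    convert hX using 1
    ext s t
    simp [ptraceLeft]
  · intro hY
    refine ⟨Y.submatrix Prod.snd Prod.snd,
      ⟨((Matrix.nonneg_iff_posSemidef.mp (h.symm.nonneg hY)).submatrix _).nonneg, ?_⟩, ?_⟩
    · convert hY using 1
      ext s t
      simp [ptraceLeft]
    · ext s t
      rfl

/-- The dual section of `ptraceSection κ L` is `I ⊗ K`. -/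
theorem ptraceSection [Nonempty κ] (h : DualPair K L) :
    DualPair (ptraceSection κ L) (oneTensor κ K) := by
  have hd : (0 : ℝ) < Fintype.card κ := by exact_mod_cast Fintype.card_pos
  have hone : ∀ b : Matrix α α ℂ, 0 ≤ b → 0 ≤ (1 : Matrix κ κ ℂ) ⊗ₖ b := fun b hb =>
    (Matrix.PosSemidef.one.kronecker (Matrix.nonneg_iff_posSemidef.mp hb)).nonneg
  have ptl_smul : ∀ (c : ℝ) (X : Matrix (κ × α) (κ × α) ℂ),
      ptraceLeft (c • X) = c • ptraceLeft X := fun c X => by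
    ext s t
    simp [ptraceLeft, Finset.mul_sum]
  have ptl_add : ∀ (X Y : Matrix (κ × α) (κ × α) ℂ),
      ptraceLeft (X + Y) = ptraceLeft X + ptraceLeft Y := fun X Y => by
    ext s t
    simp [ptraceLeft, Finset.sum_add_distrib]
  have ptl_one : ∀ b : Matrix α α ℂ, ptraceLeft ((1 : Matrix κ κ ℂ) ⊗ₖ b) =
      (Fintype.card κ : ℝ) • b := fun b => by
    ext s t
    simp [ptraceLeft]
  have e1 : (1 : Matrix (κ × α) (κ × α) ℂ) = (1 : Matrix κ κ ℂ) ⊗ₖ (1 : Matrix α α ℂ) :=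
    Matrix.one_kronecker_one.symm
  obtain ⟨c, hc, hcL⟩ := h.one_right
  obtain ⟨d, hd', hdK⟩ := h.one_left
  refine ⟨fun X => ?_, fun Y => ?_, ?_, ?_⟩
  · refine and_congr_right fun hX => ⟨?_, fun hX' => ?_⟩
    · rintro hX' _ ⟨b, hb, rfl⟩
      rw [trace_mul_one_kronecker, Matrix.trace_mul_comm]
      exact h.trace_eq hb hX'
    · refine (h.mem_right _).mpr ⟨ptraceLeft_nonneg hX, fun b hb => ?_⟩
      rw [Matrix.trace_mul_comm, ← trace_mul_one_kronecker]
      exact hX' _ ⟨b, hb, rfl⟩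
  · constructor
    · rintro ⟨b, hb, rfl⟩
      refine ⟨hone b (h.nonneg hb), fun X hX => ?_⟩
      rw [trace_mul_one_kronecker, Matrix.trace_mul_comm]
      exact h.trace_eq hb hX.2
    · rintro ⟨hY, hYX⟩
      have hYh := (Matrix.nonneg_iff_posSemidef.mp hY).isHermitian
      have hmem1 : (c / Fintype.card κ) • (1 : Matrix (κ × α) (κ × α) ℂ) ∈
          QSupermap.ptraceSection κ L := by
        refine ⟨smul_nonneg (by positivity) Matrix.PosSemidef.one.nonneg, ?_⟩
        rw [ptl_smul, e1, ptl_one, smul_smul, div_mul_cancel₀ _ hd.ne']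
        exact hcL
      -- matrices of vanishing partial trace are orthogonal to `Y`
      have horth : ∀ W : Matrix (κ × α) (κ × α) ℂ, W.IsHermitian → ptraceLeft W = 0 →
          (W * Y).trace = 0 := by
        intro W hW hW0
        -- As `-W ≤ t • 1`, a multiple of the identity in the section can be perturbed by a multiple
        -- of `W` within the section; both matrices pair to one with `Y`.
        obtain ⟨t, ht, hWt⟩ := exists_le_smul_one hW.neg
        have hm : (c / Fintype.card κ) • (1 : Matrix (κ × α) (κ × α) ℂ) +
            (c / Fintype.card κ / t) • W ∈ QSupermap.ptraceSection κ L := by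
          constructor
          · have := smul_nonneg (show 0 ≤ c / Fintype.card κ / t by positivity)
              (neg_le_iff_add_nonneg.mp hWt)
            convert this using 1
            rw [smul_add, smul_smul, div_mul_cancel₀ _ ht.ne', add_comm]
          · rw [ptl_add, ptl_smul _ W, hW0, smul_zero, add_zero]
            exact hmem1.2
        have e := hYX _ hm
        rw [add_mul, Matrix.trace_add, hYX _ hmem1, add_eq_left, Matrix.smul_mul,
          Matrix.trace_smul, smul_eq_zero] at e
        exact e.resolve_left (by positivity)
      -- With this normalization `W = Y - 1 ⊗ b` has zero partial trace, hence is orthogonal to both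
      -- `Y` and `1 ⊗ b`; therefore `Tr W² = 0`.
      set b := (Fintype.card κ : ℝ)⁻¹ • ptraceLeft Y with hb_def
      have hb : 0 ≤ b := smul_nonneg (by positivity) (ptraceLeft_nonneg hY)
      have hbh := (Matrix.nonneg_iff_posSemidef.mp (hone b hb)).isHermitian
      have hW : (Y + (-1 : ℝ) • ((1 : Matrix κ κ ℂ) ⊗ₖ b)).IsHermitian :=
        hYh.add (isHermitian_real_smul hbh _)
      have hW0 : ptraceLeft (Y + (-1 : ℝ) • ((1 : Matrix κ κ ℂ) ⊗ₖ b)) = 0 := by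
        rw [ptl_add, ptl_smul, ptl_one, hb_def, smul_smul, smul_smul, mul_assoc,
          mul_inv_cancel₀ hd.ne', mul_one, neg_one_smul, add_neg_cancel]
      have hYb : Y = (1 : Matrix κ κ ℂ) ⊗ₖ b := by
        have := eq_zero_of_trace_mul_self hW (by
          conv_lhs => enter [1, 2]
          rw [mul_add, Matrix.trace_add, horth _ hW hW0, Matrix.mul_smul, Matrix.trace_smul,
            trace_mul_one_kronecker, hW0]
          simp)
        rwa [neg_one_smul, ← sub_eq_add_neg, sub_eq_zero] at this
      refine ⟨b, (h.mem_left b).mpr ⟨hb, fun Z hZ => ?_⟩, hYb⟩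
      have e := hYX ((Fintype.card κ : ℝ)⁻¹ • ((1 : Matrix κ κ ℂ) ⊗ₖ Z))
        ⟨smul_nonneg (by positivity) (hone Z (h.symm.nonneg hZ)), by
          rwa [ptl_smul, ptl_one, smul_smul, inv_mul_cancel₀ hd.ne', one_smul]⟩
      rw [hYb, trace_mul_one_kronecker, ptl_smul, ptl_one, smul_smul, inv_mul_cancel₀ hd.ne',
        one_smul, Matrix.trace_mul_comm] at e
      exact e
  · refine ⟨c / Fintype.card κ, by positivity,
      smul_nonneg (by positivity) Matrix.PosSemidef.one.nonneg, ?_⟩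
    rw [ptl_smul, e1, ptl_one, smul_smul, div_mul_cancel₀ _ hd.ne']
    exact hcL
  · exact ⟨d, hd', d • 1, hdK, by rw [Matrix.kronecker_smul, ← e1]⟩

end DualPair

omit [Fintype α] [DecidableEq α] [DecidableEq κ] in
theorem transpose_mem_ptraceSection (hL : ∀ b ∈ L, bᵀ ∈ L) :
    ∀ X ∈ ptraceSection κ L, Xᵀ ∈ ptraceSection κ L :=
  fun _ hX => ⟨nonneg_transpose hX.1, hL _ hX.2⟩

end DualPair

/-! ### The recursion for supermaps and co-strategies. -/

section Sequence

variable (H : ℕ → Type*) [∀ i, Fintype (H i)] [∀ i, DecidableEq (H i)] [∀ i, Nonempty (H i)]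

theorem exists_dualPair_supermaps (n : ℕ) :
    (∃ L, DualPair (supermaps H n) L) ∧ ∀ b ∈ supermaps H n, bᵀ ∈ supermaps H n := by
  induction n with
  | zero =>
    exact ⟨⟨_, dualPair_states (α := H 0)⟩, fun b hb =>
      ⟨nonneg_transpose hb.1, (Matrix.trace_transpose b).trans hb.2⟩⟩
  | succ n ih =>
    obtain ⟨⟨L, h⟩, hT⟩ := ih
    have e : supermaps H (n + 1) = ptraceSection (H (n + 1)) L := h.genChannels_eq hT
    rw [e]
    exact ⟨⟨_, h.ptraceSection⟩, transpose_mem_ptraceSection (h.transpose_mem_right hT)⟩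

theorem transpose_mem_supermaps (n : ℕ) : ∀ b ∈ supermaps H n, bᵀ ∈ supermaps H n :=
  (exists_dualPair_supermaps H n).2

theorem dualPair_supermaps (n : ℕ) : DualPair (supermaps H n) (costrategies H n) := by
  obtain ⟨⟨L, h⟩, hT⟩ := exists_dualPair_supermaps H n
  have e : costrategies H n = L := h.reindex_genChannels_unit hT
  rwa [e]

theorem supermaps_succ (n : ℕ) :
    supermaps H (n + 1) = ptraceSection (H (n + 1)) (costrategies H n) :=
  (dualPair_supermaps H n).genChannels_eq (transpose_mem_supermaps H n)

/-- Both sides are the dual section of the same set, and a dual section is unique. -/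
theorem costrategies_succ (n : ℕ) :
    costrategies H (n + 1) = oneTensor (H (n + 1)) (supermaps H n) := by
  have h1 := dualPair_supermaps H (n + 1)
  have h2 : DualPair (supermaps H (n + 1)) (oneTensor (H (n + 1)) (supermaps H n)) := by
    rw [supermaps_succ]
    exact (dualPair_supermaps H n).ptraceSection
  ext Y
  rw [h1.mem_right]
  exact (h2.mem_right Y).symm

end Sequence

/-! ### Ancillas: upper bound, purification, reordering of factors. -/

section Ancilla

variable {α : Type*} [Fintype α] [DecidableEq α] {κ : Type*} [Fintype κ] [DecidableEq κ]
  {B C : Set (Matrix α α ℂ)}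

theorem sqrt_submatrix_equiv {β : Type*} [Fintype β] [DecidableEq β] (e : β ≃ α)
    {A : Matrix α α ℂ} (hA : 0 ≤ A) :
    CFC.sqrt (A.submatrix e e) = (CFC.sqrt A).submatrix e e := by
  refine CFC.sqrt_unique ?_ ?_
  · rw [Matrix.submatrix_mul_equiv, CFC.sqrt_mul_sqrt_self A hA]
  · exact ((Matrix.nonneg_iff_posSemidef.mp (CFC.sqrt_nonneg A)).submatrix e).nonneg

theorem traceNorm_submatrix_equiv {β : Type*} [Fintype β] [DecidableEq β] (e : β ≃ α)
    (A : Matrix α α ℂ) : traceNorm (A.submatrix e e) = traceNorm A := by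
  rw [traceNorm, traceNorm, Matrix.conjTranspose_submatrix, Matrix.submatrix_mul_equiv,
    sqrt_submatrix_equiv e (Matrix.posSemidef_conjTranspose_mul_self A).nonneg]
  congr 1
  exact e.sum_comp fun i => (CFC.sqrt (Aᴴ * A)) i i

theorem sqrt_one_kronecker {b : Matrix α α ℂ} (hb : 0 ≤ b) :
    CFC.sqrt ((1 : Matrix κ κ ℂ) ⊗ₖ b) = (1 : Matrix κ κ ℂ) ⊗ₖ CFC.sqrt b := by
  refine CFC.sqrt_unique ?_ ?_
  · rw [← Matrix.mul_kronecker_mul, one_mul, CFC.sqrt_mul_sqrt_self b hb]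
  · exact (Matrix.PosSemidef.one.kronecker
      (Matrix.nonneg_iff_posSemidef.mp (CFC.sqrt_nonneg b))).nonneg

omit [DecidableEq α] in
theorem tensorId_mapOfChoi_apply {Λ : Type*} (X : Matrix (κ × α) (κ × α) ℂ)
    (Z : Matrix (α × Λ) (α × Λ) ℂ) (p q : κ × Λ) :
    tensorId (mapOfChoi X) Λ Z p q = ∑ s, ∑ t, Z (t, p.2) (s, q.2) * X (p.1, t) (q.1, s) := by
  simp [tensorId, mapOfChoi_apply]

omit [DecidableEq α] in
theorem trace_tensorId_mapOfChoi {Λ : Type*} [Fintype Λ] (X : Matrix (κ × α) (κ × α) ℂ)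
    (Z : Matrix (α × Λ) (α × Λ) ℂ) :
    (tensorId (mapOfChoi X) Λ Z).trace = (mapOfChoi X (ptraceRight Z)).trace := by
  simp only [Matrix.trace, Matrix.diag_apply, tensorId_mapOfChoi_apply, mapOfChoi_apply,
    Fintype.sum_prod_type, ptraceRight, Matrix.of_apply, Finset.sum_mul]
  refine Finset.sum_congr rfl fun i _ => ?_
  rw [Finset.sum_comm]
  refine Finset.sum_congr rfl fun s _ => ?_
  rw [Finset.sum_comm]

namespace DualPair

/-- The ancilla-assisted trace norms are bounded by the base norm. -/
theorem traceNorm_tensorId_le (h : DualPair B C) (hT : ∀ b ∈ B, bᵀ ∈ B) [Nonempty κ]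
    {Λ : Type*} [Fintype Λ] [DecidableEq Λ] {X : Matrix (κ × α) (κ × α) ℂ} (hX : X.IsHermitian)
    {Z : Matrix (α × Λ) (α × Λ) ℂ} (hZ : 0 ≤ Z) (hZB : ptraceRight Z ∈ B) :
    traceNorm (tensorId (mapOfChoi X) Λ Z) ≤ baseNorm (QSupermap.ptraceSection κ C) X := by
  refine (h.ptraceSection.isGLB_baseNorm hX).2 ?_
  rintro r ⟨hr, S, ⟨hS, hSC⟩, hl, hu⟩
  have hadd : ∀ X Y : Matrix (κ × α) (κ × α) ℂ, tensorId (mapOfChoi (X - Y)) Λ Z =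
      tensorId (mapOfChoi X) Λ Z - tensorId (mapOfChoi Y) Λ Z := fun X Y => by
    ext p q
    simp [tensorId_mapOfChoi_apply, mul_sub]
  have hsmul : tensorId (mapOfChoi (r • S)) Λ Z = r • tensorId (mapOfChoi S) Λ Z := by
    ext p q
    simp [tensorId_mapOfChoi_apply, Finset.mul_sum, mul_left_comm]
  have hneg : tensorId (mapOfChoi (-(r • S))) Λ Z = -(r • tensorId (mapOfChoi S) Λ Z) := by
    rw [← hsmul]
    ext p q
    simp [tensorId_mapOfChoi_apply]
  -- The maps with Choi matrices `rS - X` and `X + rS` are completely positive, so the order bounds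
  -- survive on the output; the bounding operator has trace `r`.
  have h1 := tensorId_mapOfChoi_nonneg (sub_nonneg.mpr hu) hZ
  have h2 := tensorId_mapOfChoi_nonneg (sub_nonneg.mpr hl) hZ
  rw [hadd, hsmul, sub_nonneg] at h1
  rw [hadd, hneg, sub_nonneg] at h2
  have hSh := (Matrix.nonneg_iff_posSemidef.mp (tensorId_mapOfChoi_nonneg hS hZ)).isHermitian
  have hM : (tensorId (mapOfChoi X) Λ Z).IsHermitian := by
    have h3 := (isHermitian_real_smul hSh r).sub (Matrix.le_iff.mp h1).isHermitian
    rwa [sub_sub_cancel] at h3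
  refine (traceNorm_le_of_neg_le_of_le hM h2 h1).trans_eq ?_
  rw [Matrix.trace_smul, trace_tensorId_mapOfChoi, trace_mapOfChoi, Matrix.trace_mul_comm,
    h.trace_eq (hT _ hZB) hSC]
  simp

end DualPair

/-- The vector state `(√b ⊗ I)|ψ⟩` purifies `b`, and maps to `(I ⊗ √bᵀ) X (I ⊗ √bᵀ)`. -/
theorem exists_purification {Λ : Type*} [Fintype Λ] [DecidableEq Λ] (e : Λ ≃ α)
    (X : Matrix (κ × α) (κ × α) ℂ) {b : Matrix α α ℂ} (hb : 0 ≤ b) :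
    ∃ Z : Matrix (α × Λ) (α × Λ) ℂ, 0 ≤ Z ∧ ptraceRight Z = bᵀ ∧
      traceNorm (tensorId (mapOfChoi X) Λ Z) =
        traceNorm (CFC.sqrt ((1 : Matrix κ κ ℂ) ⊗ₖ b) * X *
          CFC.sqrt ((1 : Matrix κ κ ℂ) ⊗ₖ b)) := by
  set s := CFC.sqrt b
  have hs : s.IsHermitian := (Matrix.nonneg_iff_posSemidef.mp (CFC.sqrt_nonneg b)).isHermitian
  have hss : s * s = b := CFC.sqrt_mul_sqrt_self b hb
  -- A rank-one matrix whose vector has the entries of `√b`; this order of the indices makes the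
  -- reduced matrix `bᵀ`.
  refine ⟨Matrix.vecMulVec (fun p => s (e p.2) p.1) (star fun p => s (e p.2) p.1),
    (Matrix.posSemidef_vecMulVec_self_star _).nonneg, ?_, ?_⟩
  · ext i j
    simp only [ptraceRight, Matrix.of_apply, Matrix.vecMulVec_apply, Pi.star_apply,
      Matrix.transpose_apply, hs.apply]
    rw [e.sum_comp fun t => s t i * s j t, ← hss, Matrix.mul_apply]
    simp only [mul_comm]
  · rw [sqrt_one_kronecker hb, ← traceNorm_submatrix_equiv (Equiv.prodCongr (Equiv.refl κ) e)]
    congr 1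
    ext ⟨i, l⟩ ⟨j, l'⟩
    rw [tensorId_mapOfChoi_apply]
    simp only [Matrix.vecMulVec_apply, Pi.star_apply, hs.apply, Matrix.submatrix_apply,
      Equiv.prodCongr_apply, Prod.map, Equiv.refl_apply, Matrix.mul_apply, Fintype.sum_prod_type,
      Matrix.kroneckerMap_apply, Matrix.one_apply, Finset.sum_mul, ite_mul, one_mul, zero_mul,
      mul_ite, mul_zero]
    symm
    rw [Finset.sum_comm]
    simp only [Finset.sum_ite_eq', Finset.mem_univ, if_true]
    refine Finset.sum_congr rfl fun x _ => ?_
    rw [Finset.sum_comm]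
    simp only [Finset.sum_ite_eq, Finset.mem_univ, if_true]
    exact Finset.sum_congr rfl fun y _ => mul_right_comm _ _ _

/-- Reordering tensor factors identifies multi-time inputs with an ancilla with the extensions of
elements of `ptraceSection η L`. -/
theorem exists_moveAncilla_iff {σ η Λ : Type*} [Fintype σ] [Fintype η] [Fintype Λ]
    (L : Set (Matrix σ σ ℂ)) (P : Matrix ((η × σ) × Λ) ((η × σ) × Λ) ℂ → Prop) :
    (∃ Y ∈ ptraceSection (η × Λ) L, P (moveAncilla Y)) ↔
      ∃ Z, 0 ≤ Z ∧ ptraceRight Z ∈ ptraceSection η L ∧ P Z := by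
  have hm : ∀ Y : Matrix ((η × Λ) × σ) ((η × Λ) × σ) ℂ, moveAncilla Y =
      Y.submatrix (fun p => ((p.1.1, p.2), p.1.2)) (fun p => ((p.1.1, p.2), p.1.2)) :=
    fun _ => rfl
  have hpt : ∀ Y : Matrix ((η × Λ) × σ) ((η × Λ) × σ) ℂ,
      ptraceLeft (ptraceRight (moveAncilla Y)) = ptraceLeft Y := fun Y => by
    ext s t
    simp [ptraceLeft, ptraceRight, moveAncilla, Fintype.sum_prod_type]
  have hpr : ∀ Z : Matrix ((η × σ) × Λ) ((η × σ) × Λ) ℂ, 0 ≤ Z → 0 ≤ ptraceRight Z := by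
    intro Z hZ
    have e : ptraceRight Z = ptraceLeft (Z.submatrix Prod.swap Prod.swap) := by
      ext s t
      simp [ptraceLeft, ptraceRight]
    rw [e]
    exact ptraceLeft_nonneg ((Matrix.nonneg_iff_posSemidef.mp hZ).submatrix _).nonneg
  constructor
  · rintro ⟨Y, ⟨hY, hL⟩, hP⟩
    have hZ : 0 ≤ moveAncilla Y := by
      rw [hm]
      exact ((Matrix.nonneg_iff_posSemidef.mp hY).submatrix _).nonneg
    have hL' : ptraceLeft (ptraceRight (moveAncilla Y)) ∈ L := by rwa [hpt]
    exact ⟨moveAncilla Y, hZ, ⟨hpr _ hZ, hL'⟩, hP⟩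
  · rintro ⟨Z, hZ, ⟨-, hL⟩, hP⟩
    obtain ⟨Y, hY, rfl⟩ : ∃ Y, 0 ≤ Y ∧ moveAncilla Y = Z := by
      refine ⟨Z.submatrix (fun p => ((p.1.1, p.2), p.1.2)) (fun p => ((p.1.1, p.2), p.1.2)),
        ((Matrix.nonneg_iff_posSemidef.mp hZ).submatrix _).nonneg, ?_⟩
      ext p q
      rfl
    rw [hpt] at hL
    exact ⟨Y, ⟨hY, hL⟩, hP⟩

end Ancilla

/-! ### Ancilla-assisted norms of supermaps. -/

section AncillaValues

variable (H : ℕ → Type*) [∀ i, Fintype (H i)] [∀ i, DecidableEq (H i)] [∀ i, Nonempty (H i)]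

/-- The condition on an input with ancilla only involves the trace over `H (k + 1) × Λ`, so such
inputs are exactly the positive extensions of elements of `supermaps H (k + 1)`. -/
theorem mem_ancillaValues_iff (k : ℕ) {κ : Type*} [Fintype κ] [DecidableEq κ]
    (Φ : Matrix (Sys H (k + 1)) (Sys H (k + 1)) ℂ →ₗ[ℂ] Matrix κ κ ℂ)
    (Λ : Type*) [Fintype Λ] [DecidableEq Λ] (r : ℝ) :
    r ∈ ancillaValues H k Φ Λ ↔ ∃ Z : Matrix (Sys H (k + 1) × Λ) (Sys H (k + 1) × Λ) ℂ,
      0 ≤ Z ∧ ptraceRight Z ∈ supermaps H (k + 1) ∧ r = traceNorm (tensorId Φ Λ Z) := by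
  have e : supermapsTo H k (H (k + 1) × Λ) = ptraceSection (H (k + 1) × Λ) (costrategies H k) :=
    (dualPair_supermaps H k).genChannels_eq (transpose_mem_supermaps H k)
  rw [supermaps_succ]
  have := exists_moveAncilla_iff (η := H (k + 1)) (costrategies H k)
    (fun Z => r = traceNorm (tensorId Φ Λ Z))
  rw [← e] at this
  exact this

variable {H} {k : ℕ} {κ : Type*} [Fintype κ] [DecidableEq κ] [Nonempty κ]
  {X : Matrix (κ × Sys H (k + 1)) (κ × Sys H (k + 1)) ℂ} (hX : X.IsHermitian)

include hX

theorem le_baseNorm_of_mem_ancillaValues {Λ : Type*} [Fintype Λ] [DecidableEq Λ] {r : ℝ}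
    (hr : r ∈ ancillaValues H k (mapOfChoi X) Λ) :
    r ≤ baseNorm (ptraceSection κ (costrategies H (k + 1))) X := by
  obtain ⟨Z, hZ, hZB, rfl⟩ := (mem_ancillaValues_iff H k _ Λ r).mp hr
  exact (dualPair_supermaps H (k + 1)).traceNorm_tensorId_le
    (transpose_mem_supermaps H (k + 1)) hX hZ hZB

theorem baseNorm_le_of_mem_upperBounds_ancillaValues {Λ : Type*} [Fintype Λ] [DecidableEq Λ]
    (e : Λ ≃ Sys H (k + 1)) {u : ℝ} (hu : u ∈ upperBounds (ancillaValues H k (mapOfChoi X) Λ)) :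
    baseNorm (ptraceSection κ (costrategies H (k + 1))) X ≤ u := by
  have h := dualPair_supermaps H (k + 1)
  refine (h.ptraceSection.isLUB_traceNorm_sqrt hX).2 ?_
  rintro _ ⟨_, ⟨b, hb, rfl⟩, rfl⟩
  obtain ⟨Z, hZ, hZb, hZn⟩ := exists_purification e X (h.nonneg hb)
  refine hu ((mem_ancillaValues_iff H k _ Λ _).mpr ⟨Z, hZ, ?_, hZn.symm⟩)
  rw [hZb]
  exact transpose_mem_supermaps H (k + 1) b hb

theorem isLUB_ancillaValues {Λ : Type*} [Fintype Λ] [DecidableEq Λ] (e : Λ ≃ Sys H (k + 1)) :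
    IsLUB (ancillaValues H k (mapOfChoi X) Λ)
      (baseNorm (ptraceSection κ (costrategies H (k + 1))) X) :=
  ⟨fun _ hr => le_baseNorm_of_mem_ancillaValues hX hr,
    fun _ hu => baseNorm_le_of_mem_upperBounds_ancillaValues hX e hu⟩

theorem isLUB_iUnion_ancillaValues :
    IsLUB {r : ℝ | ∃ m : ℕ, r ∈ ancillaValues H k (mapOfChoi X) (Fin m)}
      (baseNorm (ptraceSection κ (costrategies H (k + 1))) X) :=
  ⟨fun _ ⟨_, hr⟩ => le_baseNorm_of_mem_ancillaValues hX hr,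
    fun _ hu => baseNorm_le_of_mem_upperBounds_ancillaValues hX
      (Fintype.equivFin (Sys H (k + 1))).symm fun _ hr => hu ⟨_, hr⟩⟩

end AncillaValues

end QSupermap

end

theorem mainTheorem3 (H : ℕ → Type*) [∀ i, Fintype (H i)] [∀ i, DecidableEq (H i)]
    [∀ i, Nonempty (H i)] (k : ℕ)
    (X : Matrix (Sys H (k + 2)) (Sys H (k + 2)) ℂ) (hX : X.IsHermitian)
    (Φ : Matrix (Sys H (k + 1)) (Sys H (k + 1)) ℂ →ₗ[ℂ] Matrix (H (k + 2)) (H (k + 2)) ℂ)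
    (hΦ : Φ = mapOfChoi (α := Sys H (k + 1)) (κ := H (k + 2)) X) :
    -- both gauges are norms on the Hermitian matrices
    IsNormOnHermitian (baseNorm (supermaps H (k + 2))) ∧
    IsNormOnHermitian (baseNorm (costrategies H (k + 2))) ∧
    -- supremum over pairs whose sum is a co-strategy
    IsLUB {r : ℝ | ∃ Y₁ Y₂ : Matrix (Sys H (k + 2)) (Sys H (k + 2)) ℂ,
        0 ≤ Y₁ ∧ 0 ≤ Y₂ ∧ Y₁ + Y₂ ∈ costrategies H (k + 2) ∧ r = (X * (Y₁ - Y₂)).trace.re}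
      (baseNorm (supermaps H (k + 2)) X) ∧
    -- supremum of weighted trace norms over co-strategies
    IsLUB {r : ℝ | ∃ Y ∈ costrategies H (k + 2),
        r = traceNorm (CFC.sqrt Y * X * CFC.sqrt Y)}
      (baseNorm (supermaps H (k + 2)) X) ∧
    -- infimum of order unit bounds
    IsGLB {r : ℝ | 0 < r ∧ ∃ Y ∈ supermaps H (k + 2), -(r • Y) ≤ X ∧ X ≤ r • Y}
      (baseNorm (supermaps H (k + 2)) X) ∧
    -- supremum over all finite-dimensional ancillas
    IsLUB {r : ℝ | ∃ m : ℕ, r ∈ ancillaValues H k Φ (Fin m)}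
      (baseNorm (supermaps H (k + 2)) X) ∧
    -- supremum for one ancilla of the dimension of the input space
    (∀ (L : Type*) [Fintype L] [DecidableEq L], Fintype.card L = Fintype.card (Sys H (k + 1)) →
      IsLUB (ancillaValues H k Φ L) (baseNorm (supermaps H (k + 2)) X)) ∧
    -- the dual norm, with respect to the pairing `Tr X Z`, in three forms
    IsLUB {r : ℝ | ∃ Z : Matrix (Sys H (k + 2)) (Sys H (k + 2)) ℂ, Z.IsHermitian ∧
        baseNorm (supermaps H (k + 2)) Z ≤ 1 ∧ r = (X * Z).trace.re}
      (baseNorm (costrategies H (k + 2)) X) ∧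
    baseNorm (oneTensor (H (k + 2)) (supermaps H (k + 1))) X =
      baseNorm (costrategies H (k + 2)) X ∧
    IsLUB {r : ℝ | ∃ S₀ S₁ : Matrix (Sys H (k + 2)) (Sys H (k + 2)) ℂ,
        0 ≤ S₀ ∧ 0 ≤ S₁ ∧ S₀ + S₁ ∈ supermaps H (k + 2) ∧ r = (X * (S₁ - S₀)).trace.re}
      (baseNorm (costrategies H (k + 2)) X) := by
  subst hΦ
  have h := dualPair_supermaps H (k + 2)
  have e : ptraceSection (H (k + 2)) (costrategies H (k + 1)) = supermaps H (k + 2) :=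
    (supermaps_succ H (k + 1)).symm
  refine ⟨h.isNormOnHermitian_baseNorm, h.symm.isNormOnHermitian_baseNorm,
    h.isLUB_trace_mul_sub hX, h.isLUB_traceNorm_sqrt hX, h.isGLB_baseNorm hX, ?_,
    fun L _ _ hL => ?_, h.isLUB_dual hX, ?_, ?_⟩
  · rw [← e]
    exact isLUB_iUnion_ancillaValues (κ := H (k + 2)) hX
  · rw [← e]
    exact isLUB_ancillaValues (κ := H (k + 2)) hX (Fintype.equivOfCardEq hL)
  · rw [costrategies_succ H (k + 1)]
    rfl
  -- The pairing formula for the exchanged pair, with the two summands swapped to match `S₁ - S₀`.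
  · convert h.symm.isLUB_trace_mul_sub hX using 1
    ext r
    constructor
    · rintro ⟨S₀, S₁, h₀, h₁, hS, rfl⟩
      exact ⟨S₁, S₀, h₁, h₀, (add_comm S₀ S₁) ▸ hS, rfl⟩
    · rintro ⟨S₁, S₀, h₁, h₀, hS, rfl⟩
      exact ⟨S₀, S₁, h₀, h₁, (add_comm S₁ S₀) ▸ hS, rfl⟩
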